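/- **Theorem 4.1.** Let $\mathfrak H=\mathbb Q\langle x,y\rangle$, $\mathfrak H^0=\mathbb Q+x\mathfrak Hy$, and $z_k=x^{k-1}y$ for $k\ge 1$. Let $\ast$ be the harmonic product on $\mathbb Q+\mathfrak Hy$, i.e. the bilinear product with $1\ast w=w\ast 1=w$ and $z_pv\ast z_qw=z_p(v\ast z_qw)+z_q(z_pv\ast w)+z_{p+q}(v\ast w)$ for monomials $v,w$ in the $z_k$. Let $\circledast$ be the bilinear operation on $\mathfrak Hy$ with $z_pv\circledast z_qw=z_{p+q}(v\ast w)$. Let $\varphi$ be the algebra automorphism of $\mathfrak H$ with $x\mapsto x+y$, $y\mapsto -y$, and let $L_x(w)=xw$. Let $\mathcal H$ be the commutative $\mathbb Q$-algebra of forests of (non-planar) rooted trees, with disjoint union as product and the empty forest $\mathbb I$ as unit. Let $\bullet$ be the one-vertex tree. Let $B_+:\mathcal H\to\mathcal H$ be the linear map that joins the roots of a forest to a new root. Let $\Delta$ be the algebra homomorphism $\mathcal H\to\mathcal H\otimes\mathcal H$ with $\Delta(t)=t\otimes\mathbb I+(\mathrm{id}\otimes B_+)\Delta(f)$ for a tree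 $t=B_+(f)$. There is exactly one linear map $\mathcal H\to\mathrm{End}_{\mathbb Q}(\mathfrak H)$, $f\mapsto(w\mapsto f(w))$ (the *rooted tree maps*), such that, for all letters $u\in\{x,y\}$: - $\mathbb I$ acts as the identity; - $f(wu)=M(\Delta(f)(w\otimes u))$ for every non-empty forest $f$ and every word $w$, where $M$ is the multiplication of $\mathfrak H$; - $\bullet(x)=xy$ and $\bullet(y)=-xy$; - for every non-empty forest $f$ we have $f(u)=vy$ for some $v\in\mathfrak H$, and $t(u)=v(x+2y)y$ for $t=B_+(f)$; - $(gh)(u)=g(h(u))$ for non-empty forests $g,h$. Let $\widetilde{\mathcal H}_{d\ge1}\subset\mathrm{End}(\mathfrak H)$ be the span of the rooted tree maps of the non-empty forests. Let $\mathcal F_1=\mathbb Q\,\bullet$ and $\mathcal F_d=B_+(\mathcal F_{d-1})+\bullet\,\mathcal F_{d-1}$ for $d\ge2$. Let $\widetilde{\mathcal F}\subset\mathrm{End}(\mathfrak H)$ be the sum over $d\geq 1$ of the spaces of rooted tree maps of the elements of $\mathcal F_d$. Then $\widetilde{\mathcal F}\subset\widetilde{\mathcal H}_{d\ge1}$, and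 $$\{x\,\varphi(v\ast w)\mid v,w\in\mathfrak Hy\}\subset\{f(w)\mid f\in\widetilde{\mathcal F},\ w\in\mathfrak H^0\}.$$ Conversely, $f(w)\in\{x\,\varphi(v\ast w')\mid v,w'\in\mathfrak Hy\}$ for all $w\in\mathfrak H^0$ and all $f\in\widetilde{\mathcal H}_{d\ge1}$, in particular for all $f\in\widetilde{\mathcal F}$. Consequently the rooted tree map relations are equivalent to the linear part of the Kawashima relations: for every $\mathbb Q$-vector space $V$ and every $\mathbb Q$-linear map $Z:\mathfrak H^0\to V$, one has $f(\mathfrak H^0)\subset\ker Z$ for all $f\in\widetilde{\mathcal H}_{d\ge1}$ if and only if $\varphi(v\ast w)\circledast y\in\ker Z$ for all $v,w\in\mathfrak Hy$. In particular this holds for $V=\mathbb R$ and $Z(z_{k_1}\cdots z_{k_r})=\zeta(k_1,\dots,k_r)=\sum_{m_1>\dots>m_r>0}m_1^{-k_1}\cdots m_r^{-k_r}$. -/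

import Mathlib

open scoped TensorProduct

namespace RootedTreeMaps

noncomputable section

/-! ## The noncommutative polynomial algebra in two letters -/

/-- The two letters. -/
inductive Letter
  | x
  | y

/-- `𝔥 = ℚ⟨x, y⟩`, with concatenation as product. -/
abbrev NCPoly : Type := FreeAlgebra ℚ Letter

/-- A letter as an element of `𝔥`. -/
def letter (u : Letter) : NCPoly := FreeAlgebra.ι ℚ u

/-- The generator `x`. -/
def x : NCPoly := letter Letter.x

/-- The generator `y`. -/
def y : NCPoly := letter Letter.y

/-- The subspace `𝔥 y`. -/
def Hy : Submodule ℚ NCPoly := LinearMap.range (LinearMap.mulRight ℚ y)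

/-- The subspace `x 𝔥 y`. -/
def xHy : Submodule ℚ NCPoly := Hy.map (LinearMap.mulLeft ℚ x)

/-- The subspace `𝔥⁰ = ℚ + x 𝔥 y` of admissible elements. -/
def H0 : Submodule ℚ NCPoly := Submodule.span ℚ {1} ⊔ xHy

/-- The endomorphism underlying `φ`. -/
def phiHom : NCPoly →ₐ[ℚ] NCPoly :=
  FreeAlgebra.lift ℚ (fun u => match u with
    | Letter.x => x + y
    | Letter.y => -y)

theorem phiHom_x : phiHom x = x + y := by
  simp [phiHom, x, letter]

theorem phiHom_y : phiHom y = -y := by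
  simp [phiHom, y, letter]

theorem phiHom_comp_phiHom : phiHom.comp phiHom = AlgHom.id ℚ NCPoly := by
  apply FreeAlgebra.hom_ext
  funext u
  cases u
  · change phiHom (phiHom x) = x
    rw [phiHom_x, map_add, phiHom_x, phiHom_y]
    abel
  · change phiHom (phiHom y) = y
    rw [phiHom_y, map_neg, phiHom_y, neg_neg]

/-- The automorphism `φ` of `𝔥` with `x ↦ x + y` and `y ↦ -y`. -/
def phi : NCPoly ≃ₐ[ℚ] NCPoly :=
  AlgEquiv.ofAlgHom phiHom phiHom phiHom_comp_phiHom phiHom_comp_phiHom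

/-! ## The harmonic product -/

/-- `z_k = x^(k-1) y`. -/
def z (k : ℕ+) : NCPoly := x ^ ((k : ℕ) - 1) * y

/-- The monomial `z_{k₁} ⋯ z_{k_r}`. -/
def zWord (k : List ℕ+) : NCPoly := (k.map z).prod

/-- The harmonic product of two monomials `z_{k₁} ⋯ z_{k_r}`. -/
def harmonicWord : List ℕ+ → List ℕ+ → NCPoly
  | [], w => zWord w
  | p :: v, [] => zWord (p :: v)
  | p :: v, q :: w =>
      z p * harmonicWord v (q :: w) + z q * harmonicWord (p :: v) w
        + z (p + q) * harmonicWord v w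
termination_by v w => v.length + w.length

/-- Auxiliary to `indices`; `n` counts the letters `x` read since the last `y`. -/
def indicesAux : ℕ → List Letter → List ℕ+
  | _, [] => []
  | n, Letter.x :: w => indicesAux (n + 1) w
  | n, Letter.y :: w => n.succPNat :: indicesAux 0 w

/-- The indices `k₁, …, k_r` of a word `z_{k₁} ⋯ z_{k_r}` in the letters `x`, `y`.
(Letters `x` at the very end of a word are ignored; such words are not in `ℚ + 𝔥 y`.) -/
def indices (w : FreeMonoid Letter) : List ℕ+ := indicesAux 0 w.toList

/-- Bilinear extension of an operation on the words in the letters `x`, `y`. -/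
def bilinExt (g : FreeMonoid Letter → FreeMonoid Letter → NCPoly) :
    NCPoly →ₗ[ℚ] NCPoly →ₗ[ℚ] NCPoly :=
  (FreeAlgebra.basisFreeMonoid ℚ Letter).constr ℚ fun v =>
    (FreeAlgebra.basisFreeMonoid ℚ Letter).constr ℚ fun w => g v w

/-- The harmonic product `∗`, the bilinear extension of `harmonicWord`.
Only its values on `𝔥¹ = ℚ + 𝔥 y` are meaningful. -/
def harmonicProd : NCPoly →ₗ[ℚ] NCPoly →ₗ[ℚ] NCPoly :=
  bilinExt fun v w => harmonicWord (indices v) (indices w)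

/-- The operation `z_p v ⊛ z_q w = z_{p+q} (v ∗ w)` on monomials. -/
def circledastWord : List ℕ+ → List ℕ+ → NCPoly
  | p :: v, q :: w => z (p + q) * harmonicWord v w
  | _, _ => 0

/-- The operation `⊛`, the bilinear extension of `circledastWord`.
Only its values on `𝔥 y` are meaningful. -/
def circledast : NCPoly →ₗ[ℚ] NCPoly →ₗ[ℚ] NCPoly :=
  bilinExt fun v w => circledastWord (indices v) (indices w)

/-! ### The operations take the intended values on the monomials `z_{k₁} ⋯ z_{k_r}` -/

/-- The word `z_{k₁} ⋯ z_{k_r}`. -/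
def zWordFM (k : List ℕ+) : FreeMonoid Letter :=
  (k.map fun p : ℕ+ => FreeMonoid.of Letter.x ^ ((p : ℕ) - 1) * FreeMonoid.of Letter.y).prod

theorem basisFreeMonoid_apply (w : FreeMonoid Letter) :
    FreeAlgebra.basisFreeMonoid ℚ Letter w = FreeMonoid.lift letter w := by
  simp only [FreeAlgebra.basisFreeMonoid, Module.Basis.map_apply]
  change FreeAlgebra.equivMonoidAlgebraFreeMonoid.symm (MonoidAlgebra.single w 1) = _
  simp [FreeAlgebra.equivMonoidAlgebraFreeMonoid]
  rfl

theorem basisFreeMonoid_zWordFM (k : List ℕ+) :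
    FreeAlgebra.basisFreeMonoid ℚ Letter (zWordFM k) = zWord k := by
  rw [basisFreeMonoid_apply, zWordFM, zWord, map_list_prod, List.map_map]
  refine congrArg List.prod (List.map_congr_left fun p _ => ?_)
  simp [z, x, y]

theorem indicesAux_replicate (n m : ℕ) (w : List Letter) :
    indicesAux n (List.replicate m Letter.x ++ w) = indicesAux (n + m) w := by
  induction m generalizing n with
  | zero => rfl
  | succ m ih =>
    rw [List.replicate_succ, List.cons_append, indicesAux, ih, Nat.add_right_comm, Nat.add_assoc]

theorem indices_zWordFM (k : List ℕ+) : indices (zWordFM k) = k := by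
  induction k with
  | nil => rfl
  | cons p k ih =>
    have h : (zWordFM (p :: k)).toList =
        List.replicate ((p : ℕ) - 1) Letter.x ++ Letter.y :: (zWordFM k).toList := by
      have hp : ∀ m : ℕ, (FreeMonoid.of Letter.x ^ m).toList = List.replicate m Letter.x := by
        intro m
        induction m with
        | zero => rfl
        | succ m ihm =>
          rw [pow_succ', FreeMonoid.toList_mul, ihm, FreeMonoid.toList_of, List.replicate_succ]
          rfl
      simp [zWordFM, FreeMonoid.toList_mul, hp]
    rw [indices, h, indicesAux_replicate, indicesAux]
    rw [indices] at ih
    rw [ih]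
    congr 1
    apply PNat.eq
    have := p.pos
    simp only [Nat.succPNat_coe]
    omega

theorem bilinExt_zWord (g : FreeMonoid Letter → FreeMonoid Letter → NCPoly) (v w : List ℕ+) :
    bilinExt g (zWord v) (zWord w) = g (zWordFM v) (zWordFM w) := by
  rw [← basisFreeMonoid_zWordFM, ← basisFreeMonoid_zWordFM, bilinExt, Module.Basis.constr_basis,
    Module.Basis.constr_basis]

theorem harmonicProd_zWord (v w : List ℕ+) : harmonicProd (zWord v) (zWord w) = harmonicWord v w := by
  rw [harmonicProd, bilinExt_zWord, indices_zWordFM, indices_zWordFM]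

theorem circledast_zWord (v w : List ℕ+) :
    circledast (zWord v) (zWord w) = circledastWord v w := by
  rw [circledast, bilinExt_zWord, indices_zWordFM, indices_zWordFM]

/-! ## Multiple zeta values -/

/-- `ζ(k₁, …, k_r) = ∑_{m₁ > ⋯ > m_r > 0} 1 / (m₁^{k₁} ⋯ m_r^{k_r})`. -/
def mzv (k : List ℕ+) : ℝ :=
  ∑' m : {m : Fin k.length → ℕ // StrictAnti m ∧ ∀ i, 0 < m i},
    ∏ i, 1 / ((m.1 i : ℝ) ^ (k.get i : ℕ))

/-- The `ℚ`-linear map `Z : 𝔥⁰ → ℝ` with `z_{k₁} ⋯ z_{k_r} ↦ ζ(k₁, …, k_r)`. -/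
def zetaMap : H0 →ₗ[ℚ] ℝ :=
  ((FreeAlgebra.basisFreeMonoid ℚ Letter).constr ℚ fun w => mzv (indices w)).comp H0.subtype

/-! ## Rooted trees and forests -/

/-- Finite rooted trees with an ordering of the branches at each vertex. -/
inductive PlanarTree
  | node : List PlanarTree → PlanarTree

/-- Two planar trees are related if one arises from the other by permuting the branches at
one vertex. -/
inductive PlanarTree.Step : PlanarTree → PlanarTree → Prop
  | perm {l₁ l₂ : List PlanarTree} : l₁.Perm l₂ →
      PlanarTree.Step (PlanarTree.node l₁) (PlanarTree.node l₂)
  | branch {s t : PlanarTree} (l₁ l₂ : List PlanarTree) : PlanarTree.Step s t →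
      PlanarTree.Step (PlanarTree.node (l₁ ++ s :: l₂)) (PlanarTree.node (l₁ ++ t :: l₂))

/-- Rooted trees without plane structure. (`Quot` is the quotient by the generated
equivalence relation.) -/
def RootedTree : Type := Quot PlanarTree.Step

/-- The rooted tree underlying a planar one. -/
def RootedTree.mk (t : PlanarTree) : RootedTree := Quot.mk PlanarTree.Step t

/-- A planar representative of a rooted tree. -/
def RootedTree.out (t : RootedTree) : PlanarTree := Quot.out t

theorem RootedTree.mk_out (t : RootedTree) : RootedTree.mk t.out = t := Quot.out_eq t

theorem mk_node_perm {l₁ l₂ : List PlanarTree} (h : l₁.Perm l₂) :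
    RootedTree.mk (PlanarTree.node l₁) = RootedTree.mk (PlanarTree.node l₂) :=
  Quot.sound (PlanarTree.Step.perm h)

theorem mk_node_branch (l₁ l₂ : List PlanarTree) {s t : PlanarTree}
    (h : RootedTree.mk s = RootedTree.mk t) :
    RootedTree.mk (PlanarTree.node (l₁ ++ s :: l₂)) =
      RootedTree.mk (PlanarTree.node (l₁ ++ t :: l₂)) :=
  congrArg (Quot.lift (fun s => RootedTree.mk (PlanarTree.node (l₁ ++ s :: l₂)))
    fun _ _ hst => Quot.sound (PlanarTree.Step.branch l₁ l₂ hst)) h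

/-- The rooted tree obtained by connecting the roots of all trees of a forest to a new root.
(Planar representatives of the trees are chosen; the result does not depend on them, see
`graft_map_mk`.) -/
def graft (s : Multiset RootedTree) : RootedTree :=
  Quotient.liftOn s (fun l : List RootedTree => RootedTree.mk (PlanarTree.node (l.map RootedTree.out)))
    fun _ _ h => mk_node_perm (h.map _)

theorem graft_map_mk (l : List PlanarTree) :
    graft (l.map RootedTree.mk : List RootedTree) = RootedTree.mk (PlanarTree.node l) := by
  have key : ∀ (l l₀ : List PlanarTree),
      RootedTree.mk (PlanarTree.node (l₀ ++ (l.map RootedTree.mk).map RootedTree.out)) =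
        RootedTree.mk (PlanarTree.node (l₀ ++ l)) := by
    intro l
    induction l with
    | nil => intro l₀; rfl
    | cons t l ih =>
      intro l₀
      have h₂ := ih (l₀ ++ [t])
      simp only [List.append_assoc, List.singleton_append] at h₂
      rw [List.map_cons, List.map_cons, ← h₂]
      exact mk_node_branch l₀ _ (RootedTree.mk_out _)
  exact key l []

/-- The `ℚ`-algebra `ℋ` of forests: the free commutative algebra on the rooted trees, with the
disjoint union of forests as product and the empty forest as unit. -/
abbrev ForestAlg : Type := MvPolynomial RootedTree ℚ

/-- A rooted tree as an element of `ℋ`. -/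
def tree (t : RootedTree) : ForestAlg := MvPolynomial.X t

/-- A forest as an element of `ℋ`. -/
def forest (s : Multiset RootedTree) : ForestAlg := (s.map tree).prod

/-- The tree with one vertex. -/
def vertex : ForestAlg := tree (graft 0)

/-- The linear map `B₊` on `ℋ`. -/
def bPlus : ForestAlg →ₗ[ℚ] ForestAlg :=
  (MvPolynomial.basisMonomials RootedTree ℚ).constr ℚ fun s => tree (graft (Finsupp.toMultiset s))

theorem forest_eq_monomial (s : RootedTree →₀ ℕ) :
    forest (Finsupp.toMultiset s) = MvPolynomial.monomial s 1 := by
  rw [MvPolynomial.monomial_eq, forest, Finsupp.toMultiset_map, Finsupp.prod_toMultiset]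
  rw [Finsupp.prod_mapDomain_index (by simp) (by intros; rw [pow_add])]
  simp [tree]

theorem bPlus_forest (s : Multiset RootedTree) : bPlus (forest s) = tree (graft s) := by
  classical
  rw [← Multiset.toFinsupp_toMultiset s, forest_eq_monomial, bPlus,
    ← congrFun (MvPolynomial.coe_basisMonomials RootedTree ℚ) (Multiset.toFinsupp s),
    Module.Basis.constr_basis]

/-- The coproduct of a tree, computed from a planar representative `t = B₊(f)` by
`Δ(t) = t ⊗ 𝕀 + (id ⊗ B₊)(Δ(f))`. -/
def coproductPlanar : PlanarTree → ForestAlg ⊗[ℚ] ForestAlg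
  | PlanarTree.node l =>
      tree (RootedTree.mk (PlanarTree.node l)) ⊗ₜ[ℚ] 1
        + TensorProduct.map LinearMap.id bPlus (l.attach.map fun t => coproductPlanar t.1).prod
termination_by t => sizeOf t
decreasing_by
  have := List.sizeOf_lt_of_mem t.2
  simp only [PlanarTree.node.sizeOf_spec]
  omega

theorem coproductPlanar_node (l : List PlanarTree) :
    coproductPlanar (PlanarTree.node l) =
      tree (RootedTree.mk (PlanarTree.node l)) ⊗ₜ[ℚ] 1
        + TensorProduct.map LinearMap.id bPlus (l.map coproductPlanar).prod := by
  rw [coproductPlanar, List.attach_map_val (f := coproductPlanar)]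

theorem coproductPlanar_step {s t : PlanarTree} (h : PlanarTree.Step s t) :
    coproductPlanar s = coproductPlanar t := by
  induction h with
  | perm h =>
    rw [coproductPlanar_node, coproductPlanar_node, mk_node_perm h, (h.map coproductPlanar).prod_eq]
  | branch l₁ l₂ h ih =>
    rw [coproductPlanar_node, coproductPlanar_node, mk_node_branch l₁ l₂ (Quot.sound h)]
    simp only [List.map_append, List.map_cons, ih]

/-- The coproduct of a rooted tree. -/
def coproductTree : RootedTree → ForestAlg ⊗[ℚ] ForestAlg :=
  Quot.lift coproductPlanar fun _ _ h => coproductPlanar_step h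

/-- The coproduct `Δ` on `ℋ`, the multiplicative extension of `coproductTree`. -/
def coproduct : ForestAlg →ₐ[ℚ] ForestAlg ⊗[ℚ] ForestAlg :=
  MvPolynomial.aeval coproductTree

/-- The recursion that defines the coproduct of a tree `B₊(f)`. -/
theorem coproduct_tree_graft (s : Multiset RootedTree) :
    coproduct (tree (graft s)) = tree (graft s) ⊗ₜ[ℚ] 1
      + TensorProduct.map LinearMap.id bPlus (coproduct (forest s)) := by
  induction s using Quotient.inductionOn with
  | h l =>
    obtain ⟨l, rfl⟩ : ∃ l' : List PlanarTree, l'.map RootedTree.mk = l :=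
      ⟨l.map RootedTree.out, by simp [RootedTree.mk_out, Function.comp_def]⟩
    have h₁ : ∀ t : RootedTree, coproduct (tree t) = coproductTree t := fun t => by
      simp [coproduct, tree]
    have h₂ : coproduct (forest ((l.map RootedTree.mk : List RootedTree) : Multiset RootedTree)) =
        (l.map coproductPlanar).prod := by
      simp only [forest, Multiset.map_coe, Multiset.prod_coe, map_list_prod, List.map_map]
      congr 2
      funext t
      exact h₁ _
    change coproduct (tree (graft ((l.map RootedTree.mk : List RootedTree) : Multiset RootedTree)))
      = tree (graft ((l.map RootedTree.mk : List RootedTree) : Multiset RootedTree)) ⊗ₜ[ℚ] 1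
        + TensorProduct.map LinearMap.id bPlus
          (coproduct (forest ((l.map RootedTree.mk : List RootedTree) : Multiset RootedTree)))
    rw [h₁, h₂, graft_map_mk]
    exact coproductPlanar_node l

/-! ## Rooted tree maps -/

/-- The action `Δ ↦ M (Δ (w ⊗ u))` of an element `Δ` of `ℋ ⊗ ℋ`, where `ℋ` acts on `𝔥` by `ρ`
and `M` is the multiplication of `𝔥`. -/
def tensorAct (ρ : ForestAlg →ₗ[ℚ] Module.End ℚ NCPoly) (D : ForestAlg ⊗[ℚ] ForestAlg)
    (w u : NCPoly) : NCPoly :=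
  LinearMap.mul' ℚ NCPoly
    (TensorProduct.homTensorHomMap (RingHom.id ℚ) NCPoly NCPoly NCPoly NCPoly
      (TensorProduct.map ρ ρ D) (w ⊗ₜ[ℚ] u))

/-- The recursive definition of the rooted tree maps: `ρ f` is the rooted tree map of `f ∈ ℋ`. -/
structure IsRootedTreeMap (ρ : ForestAlg →ₗ[ℚ] Module.End ℚ NCPoly) : Prop where
  /-- The empty forest acts as the identity. -/
  empty : ρ (forest 0) = LinearMap.id
  /-- `f(w u) = M(Δ(f)(w ⊗ u))` for a non-empty forest `f`, a word `w` and a letter `u`. -/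
  mul_letter : ∀ s : Multiset RootedTree, s ≠ 0 → ∀ (w : FreeMonoid Letter) (u : Letter),
    ρ (forest s) (FreeMonoid.lift letter w * letter u) =
      tensorAct ρ (coproduct (forest s)) (FreeMonoid.lift letter w) (letter u)
  /-- The value of the one-vertex tree at `x`. -/
  vertex_x : ρ vertex x = x * y
  /-- The value of the one-vertex tree at `y`. -/
  vertex_y : ρ vertex y = -(x * y)
  /-- `t(u) = R_y R_{x+2y} R_y⁻¹ f(u)` for `t = B₊(f)`, that is, `f(u) = v y` for some `v`
  and `t(u) = v (x + 2 y) y`. -/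
  tree_letter : ∀ s : Multiset RootedTree, s ≠ 0 → ∀ u : Letter, ∃ v : NCPoly,
    ρ (forest s) (letter u) = v * y ∧ ρ (tree (graft s)) (letter u) = v * (x + 2 * y) * y
  /-- `(g h)(u) = g(h(u))` for non-empty forests `g`, `h`. -/
  product_letter : ∀ s t : Multiset RootedTree, s ≠ 0 → t ≠ 0 → ∀ u : Letter,
    ρ (forest s * forest t) (letter u) = ρ (forest s) (ρ (forest t) (letter u))

/-- The space of rooted tree maps of non-zero degree, spanned by the maps of the non-empty
forests. -/
def tildeHPos (ρ : ForestAlg →ₗ[ℚ] Module.End ℚ NCPoly) : Submodule ℚ (Module.End ℚ NCPoly) :=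
  Submodule.span ℚ {f | ∃ s : Multiset RootedTree, s ≠ 0 ∧ f = ρ (forest s)}

/-- The spaces `ℱ_d`, `d ≥ 1`: `ℱ_1` is spanned by the one-vertex tree `•`, and
`ℱ_d = B₊(ℱ_{d-1}) + • ℱ_{d-1}` for `d ≥ 2`. -/
def calF : ℕ → Submodule ℚ ForestAlg
  | 0 => ⊥
  | 1 => Submodule.span ℚ {vertex}
  | d + 2 => (calF (d + 1)).map bPlus ⊔ (calF (d + 1)).map (LinearMap.mulLeft ℚ vertex)

/-- The space `ℱ̃ = ⨁_{d ≥ 1} ℱ̃_d`, where `ℱ̃_d` is the space of the rooted tree maps of the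
elements of `ℱ_d`. -/
def tildeF (ρ : ForestAlg →ₗ[ℚ] Module.End ℚ NCPoly) : Submodule ℚ (Module.End ℚ NCPoly) :=
  ⨆ d : ℕ, ⨆ _ : 1 ≤ d, (calF d).map ρ

/-- The set `{f(w) | f ∈ V, w ∈ 𝔥⁰}` of values of a space `V` of endomorphisms. -/
def values (V : Submodule ℚ (Module.End ℚ NCPoly)) : Set NCPoly :=
  {a | ∃ f ∈ V, ∃ w ∈ H0, a = f w}

/-- The set `L_x φ(𝔥y ∗ 𝔥y) = {x φ(v ∗ w) | v, w ∈ 𝔥 y}`. -/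
def kawashimaSet : Set NCPoly :=
  {a | ∃ v ∈ Hy, ∃ w ∈ Hy, a = x * phi (harmonicProd v w)}

/-- The kernel of a linear map `Z` on `𝔥⁰`, as a subspace of `𝔥`. -/
def kerZ {M : Type*} [AddCommGroup M] [Module ℚ M] (Z : H0 →ₗ[ℚ] M) : Submodule ℚ NCPoly :=
  (LinearMap.ker Z).map H0.subtype

end

end RootedTreeMaps

open RootedTreeMaps

/-!
Write `z = x + y`, and let `𝔥¹ = ℚ + 𝔥 y` act on `𝔥` by `a · (w xⁿ) = (a ∗ w) xⁿ` (`act`). The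
harmonic product being associative and commutative, these operators commute, so the recursion
`G_{fg} = G_f ∗ G_g`, `G_{B₊(f)} = Λ(G_f)` attaches to every `f ∈ ℋ` an element `G_f ∈ 𝔥¹` and an
operator `A_f = act G_f` (`forestOp`). Here `Λ` (`graftOp`) is the conjugate by `φ` of
`v y ↦ v (x + 2 y) y`. The crucial identity is

  `A_f(w z u) = ∑ A_{f'}(w) z A_{f''}(u)`, where `Δ(f) = ∑ f' ⊗ f''` (`forestOp_mul_add_mul`).

It is multiplicative in `f`, and passes from `f` to `B₊(f)` by induction on the last letter of `u`,
using the right recursion `act_graftOp_mul_y` of `Λ(a) ∗ w`. Conjugating by `φ`, which exchanges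
`x` and `z`, one sees that

  `f(1) = ε(f)`, `f(x w) = x φ(G_f ∗ φ(w))`, `f(z w) = z f(w)`

satisfies the recursive definition of the rooted tree maps (`isRootedTreeMap_rho`). Uniqueness is an
induction on the number of vertices (`IsRootedTreeMap.unique`): all terms of `Δ(f)` other than
`f ⊗ 𝕀` have a first factor of lower degree.

As `G_f ∈ 𝔥 y` for a non-empty forest, the formula for `f(x w)` shows that all values on `𝔥⁰` lie in
`x φ(𝔥 y ∗ 𝔥 y)`. Conversely every element of `𝔥 y` is `G_f` for some `f ∈ ℱ`
(`exists_calFSum_forestOp_eq`): the elements `Λ(v y) = v (x - y) y` account for `B₊(ℱ)`, and modulo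
them the products `y ∗ v y` exhaust `𝔥 y`. After removing last letters this says that
`v ↦ P(y ∗ v) + 2 v`, with `P(w x) = P(w y) = w`, is onto in each degree; it is proved for a family
of operators `v ↦ P(y ∗ v) + c v`, with `P(w x) = a w` and `P(w y) = b w`, that is stable under the
passage to the next lower degree (`exists_dropLast_act_y_add`). The relations are then compared by
means of `x a = a ⊛ y` for `a ∈ 𝔥 y` (`circledast_y`).
-/

namespace RootedTreeMaps

noncomputable section

/-! ### Words and the structure of `𝔥` -/

theorem lift_letter_induction {p : NCPoly → Prop}
    (word : ∀ w : FreeMonoid Letter, p (FreeMonoid.lift letter w))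
    (add : ∀ a b, p a → p b → p (a + b)) (smul : ∀ (c : ℚ) a, p a → p (c • a)) (w : NCPoly) :
    p w := by
  have hw := (FreeAlgebra.basisFreeMonoid ℚ Letter).mem_span w
  induction hw using Submodule.span_induction with
  | mem _ h =>
    obtain ⟨v, rfl⟩ := h
    rw [basisFreeMonoid_apply]
    exact word v
  | zero => simpa using smul 0 _ (word 1)
  | add a b _ _ ha hb => exact add a b ha hb
  | smul c a _ ha => exact smul c a ha

theorem induction_left {p : NCPoly → Prop} (one : p 1)
    (x_mul : ∀ w, p w → p (x * w)) (y_mul : ∀ w, p w → p (y * w))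
    (add : ∀ a b, p a → p b → p (a + b)) (smul : ∀ (c : ℚ) a, p a → p (c • a)) (w : NCPoly) :
    p w := by
  refine lift_letter_induction (fun v => ?_) add smul w
  induction v using FreeMonoid.inductionOn' with
  | one => simpa using one
  | of_mul u v ih =>
    rw [map_mul, FreeMonoid.lift_eval_of]
    cases u
    · exact x_mul _ ih
    · exact y_mul _ ih

theorem induction_right {p : NCPoly → Prop} (one : p 1)
    (mul_x : ∀ w, p w → p (w * x)) (mul_y : ∀ w, p w → p (w * y))
    (add : ∀ a b, p a → p b → p (a + b)) (smul : ∀ (c : ℚ) a, p a → p (c • a)) (w : NCPoly) :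
    p w := by
  refine lift_letter_induction (fun v => ?_) add smul w
  induction v using List.reverseRecOn with
  | nil => exact one
  | append_singleton v u ih =>
    change p (FreeMonoid.lift letter (FreeMonoid.ofList v * FreeMonoid.of u))
    rw [map_mul, FreeMonoid.lift_eval_of]
    cases u
    · exact mul_x _ ih
    · exact mul_y _ ih

@[simp] theorem zWord_nil : zWord [] = 1 := rfl

theorem zWord_cons (p : ℕ+) (k : List ℕ+) : zWord (p :: k) = z p * zWord k := by
  simp [zWord]

theorem zWord_concat (k : List ℕ+) (p : ℕ+) : zWord (k ++ [p]) = zWord k * z p := by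
  simp [zWord]

theorem z_succPNat (n : ℕ) : z n.succPNat = x ^ n * y := by
  simp [z]

theorem z_one : z 1 = y := by simp [z]

theorem z_add (p q : ℕ+) : z (p + q) = x ^ (p : ℕ) * z q := by
  have := p.pos
  have := q.pos
  rw [z, z, ← mul_assoc, ← pow_add]
  congr 2
  rw [PNat.add_coe]
  omega

theorem x_mul_z (p : ℕ+) : x * z p = z (p + 1) := by
  rw [add_comm, z_add]; simp

/-- The monomials `z_{k₁} ⋯ z_{k_r} xⁿ` span `𝔥`. -/
theorem induction_zWord {p : NCPoly → Prop} (word : ∀ (k : List ℕ+) (n : ℕ), p (zWord k * x ^ n))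
    (add : ∀ a b, p a → p b → p (a + b)) (smul : ∀ (c : ℚ) a, p a → p (c • a)) (w : NCPoly) :
    p w := by
  refine lift_letter_induction (fun v => ?_) add smul w
  suffices h : ∃ (k : List ℕ+) (n : ℕ), FreeMonoid.lift letter v = zWord k * x ^ n by
    obtain ⟨k, n, h⟩ := h
    rw [h]
    exact word k n
  induction v using List.reverseRecOn with
  | nil => exact ⟨[], 0, by simp [zWord]; rfl⟩
  | append_singleton v u ih =>
    obtain ⟨k, n, h⟩ := ih
    have h' : FreeMonoid.lift letter (v ++ [u] : List Letter) = zWord k * x ^ n * letter u := by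
      change FreeMonoid.lift letter (FreeMonoid.ofList v * FreeMonoid.of u) = _
      rw [map_mul, FreeMonoid.lift_eval_of, ← h]
      rfl
    cases u
    · exact ⟨k, n + 1, by rw [h', pow_succ, ← mul_assoc]; rfl⟩
    · exact ⟨k ++ [n.succPNat], 0, by
        rw [h', zWord_concat, z_succPNat, pow_zero, mul_one, mul_assoc]; rfl⟩

/-- The subspace `𝔥¹ = ℚ + 𝔥 y`, as the span of the monomials `z_{k₁} ⋯ z_{k_r}`. -/
def H1 : Submodule ℚ NCPoly := Submodule.span ℚ (Set.range zWord)

theorem zWord_mem_H1 (k : List ℕ+) : zWord k ∈ H1 := Submodule.subset_span ⟨k, rfl⟩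

theorem mul_y_mem_H1 (w : NCPoly) : w * y ∈ H1 := by
  induction w using induction_zWord with
  | word k n =>
    rw [mul_assoc, ← z_succPNat, ← zWord_concat]
    exact zWord_mem_H1 _
  | add a b ha hb => rw [add_mul]; exact add_mem ha hb
  | smul c a ha => rw [smul_mul_assoc]; exact H1.smul_mem c ha

theorem mem_Hy {a : NCPoly} : a ∈ Hy ↔ ∃ v, a = v * y := by
  simp [Hy, eq_comm]

theorem mul_y_mem_Hy (w : NCPoly) : w * y ∈ Hy := mem_Hy.2 ⟨w, rfl⟩

theorem Hy_le_H1 : Hy ≤ H1 := by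
  intro a ha
  obtain ⟨v, rfl⟩ := mem_Hy.1 ha
  exact mul_y_mem_H1 v

theorem mul_mem_Hy (a : NCPoly) {b : NCPoly} (hb : b ∈ Hy) : a * b ∈ Hy := by
  obtain ⟨v, rfl⟩ := mem_Hy.1 hb
  exact mem_Hy.2 ⟨a * v, by rw [mul_assoc]⟩

theorem mul_z_mem_Hy (a : NCPoly) (p : ℕ+) : a * z p ∈ Hy :=
  mul_mem_Hy _ (mul_mem_Hy _ (mem_Hy.2 ⟨1, by simp⟩))

theorem zWord_concat_mem_Hy (k : List ℕ+) (p : ℕ+) : zWord (k ++ [p]) ∈ Hy := by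
  rw [zWord_concat]
  exact mul_z_mem_Hy _ _

/-- The subspace `𝔥 y` is spanned by the monomials `z_{k₁} ⋯ z_{k_r}` with `r ≥ 1`. -/
theorem Hy_induction {p : (a : NCPoly) → a ∈ Hy → Prop}
    (word : ∀ (k : List ℕ+) (n : ℕ+), p (zWord (k ++ [n])) (zWord_concat_mem_Hy k n))
    (add : ∀ a b ha hb, p a ha → p b hb → p (a + b) (add_mem ha hb))
    (smul : ∀ (c : ℚ) a ha, p a ha → p (c • a) (Hy.smul_mem c ha)) {a : NCPoly}
    (ha : a ∈ Hy) : p a ha := by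
  suffices h : ∀ v : NCPoly, ∀ h : v * y ∈ Hy, p (v * y) h by
    obtain ⟨v, rfl⟩ := mem_Hy.1 ha
    exact h v ha
  intro v
  induction v using induction_zWord with
  | word k n =>
    have e : zWord k * x ^ n * y = zWord (k ++ [n.succPNat]) := by
      rw [mul_assoc, ← z_succPNat, ← zWord_concat]
    simpa only [e] using fun _ => word k n.succPNat
  | add a b ha hb =>
    simp only [add_mul]
    exact fun _ => add _ _ _ _ (ha (mul_y_mem_Hy a)) (hb (mul_y_mem_Hy b))
  | smul c a ha =>
    simp only [smul_mul_assoc]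
    exact fun _ => smul _ _ _ (ha (mul_y_mem_Hy a))

theorem phi_x : phi x = x + y := phiHom_x

theorem phi_y : phi y = -y := phiHom_y

theorem phi_phi (w : NCPoly) : phi (phi w) = w := DFunLike.congr_fun phiHom_comp_phiHom w

theorem phi_mem_Hy {a : NCPoly} (ha : a ∈ Hy) : phi a ∈ Hy := by
  obtain ⟨v, rfl⟩ := mem_Hy.1 ha
  rw [map_mul, phi_y, mul_neg, ← neg_mul]
  exact mul_y_mem_Hy _

/-! ### Removing the last letter -/

/-- Auxiliary to `lastCoeff`, with the words read backwards: the word without its last letter if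
that letter is `u`, and `0` otherwise. -/
def lastCoeffWord : Letter → List Letter → NCPoly
  | Letter.x, Letter.x :: w => FreeMonoid.lift letter (FreeMonoid.ofList w.reverse)
  | Letter.y, Letter.y :: w => FreeMonoid.lift letter (FreeMonoid.ofList w.reverse)
  | _, _ => 0

/-- The linear map `𝔥 → 𝔥` with `w u ↦ w` that kills `1` and the words not ending in the
letter `u`. -/
def lastCoeff (u : Letter) : NCPoly →ₗ[ℚ] NCPoly :=
  (FreeAlgebra.basisFreeMonoid ℚ Letter).constr ℚ fun w => lastCoeffWord u w.toList.reverse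

/-- The constant term of a noncommutative polynomial. -/
def constCoeff : NCPoly →ₐ[ℚ] ℚ := FreeAlgebra.lift ℚ fun _ => 0

@[simp] theorem constCoeff_x : constCoeff x = 0 := by simp [constCoeff, x, letter]
@[simp] theorem constCoeff_y : constCoeff y = 0 := by simp [constCoeff, y, letter]

theorem lastCoeff_lift (u : Letter) (w : FreeMonoid Letter) :
    lastCoeff u (FreeMonoid.lift letter w) = lastCoeffWord u w.toList.reverse := by
  rw [← basisFreeMonoid_apply, lastCoeff, Module.Basis.constr_basis]

theorem lastCoeff_lift_mul (u v : Letter) (w : FreeMonoid Letter) :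
    lastCoeff u (FreeMonoid.lift letter w * letter v) =
      match u, v with
      | Letter.x, Letter.x => FreeMonoid.lift letter w
      | Letter.y, Letter.y => FreeMonoid.lift letter w
      | _, _ => 0 := by
  have h : FreeMonoid.lift letter w * letter v = FreeMonoid.lift letter (w * FreeMonoid.of v) := by
    simp
  rw [h, lastCoeff_lift, FreeMonoid.toList_mul, FreeMonoid.toList_of, List.reverse_concat]
  cases u <;> cases v <;> simp [lastCoeffWord]

@[simp] theorem lastCoeff_one (u : Letter) : lastCoeff u 1 = 0 := by
  have := lastCoeff_lift u 1
  rw [map_one] at this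
  rw [this]
  cases u <;> rfl

@[simp] theorem lastCoeff_x_mul_x (w : NCPoly) : lastCoeff Letter.x (w * x) = w := by
  induction w using lift_letter_induction with
  | word w => exact lastCoeff_lift_mul _ _ _
  | add a b ha hb => rw [add_mul, map_add, ha, hb]
  | smul c a ha => rw [smul_mul_assoc, map_smul, ha]

@[simp] theorem lastCoeff_x_mul_y (w : NCPoly) : lastCoeff Letter.x (w * y) = 0 := by
  induction w using lift_letter_induction with
  | word w => exact lastCoeff_lift_mul _ _ _
  | add a b ha hb => rw [add_mul, map_add, ha, hb, add_zero]
  | smul c a ha => rw [smul_mul_assoc, map_smul, ha, smul_zero]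

@[simp] theorem lastCoeff_y_mul_x (w : NCPoly) : lastCoeff Letter.y (w * x) = 0 := by
  induction w using lift_letter_induction with
  | word w => exact lastCoeff_lift_mul _ _ _
  | add a b ha hb => rw [add_mul, map_add, ha, hb, add_zero]
  | smul c a ha => rw [smul_mul_assoc, map_smul, ha, smul_zero]

@[simp] theorem lastCoeff_y_mul_y (w : NCPoly) : lastCoeff Letter.y (w * y) = w := by
  induction w using lift_letter_induction with
  | word w => exact lastCoeff_lift_mul _ _ _
  | add a b ha hb => rw [add_mul, map_add, ha, hb]
  | smul c a ha => rw [smul_mul_assoc, map_smul, ha]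

/-! ### The harmonic product -/

@[simp] theorem harmonicWord_nil_left (w : List ℕ+) : harmonicWord [] w = zWord w := by
  rw [harmonicWord]

@[simp] theorem harmonicWord_nil_right (w : List ℕ+) : harmonicWord w [] = zWord w := by
  cases w <;> rw [harmonicWord]

theorem harmonicWord_cons (p q : ℕ+) (v w : List ℕ+) :
    harmonicWord (p :: v) (q :: w) =
      z p * harmonicWord v (q :: w) + z q * harmonicWord (p :: v) w
        + z (p + q) * harmonicWord v w := by
  rw [harmonicWord]

theorem harmonicWord_comm (v w : List ℕ+) : harmonicWord v w = harmonicWord w v := by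
  induction v generalizing w with
  | nil => simp
  | cons p v ihv =>
    induction w with
    | nil => simp
    | cons q w ihw =>
      rw [harmonicWord_cons, harmonicWord_cons, ihv, ihw, ihv, add_comm q p]
      abel

/-- The recursion for the harmonic product that splits off the last factors. -/
theorem harmonicWord_concat (p q : ℕ+) (v w : List ℕ+) :
    harmonicWord (v ++ [p]) (w ++ [q]) =
      harmonicWord v (w ++ [q]) * z p + harmonicWord (v ++ [p]) w * z q
        + harmonicWord v w * z (p + q) := by
  induction v generalizing w with
  | nil =>
    induction w with
    | nil => simp [harmonicWord_cons, zWord_cons]; abel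
    | cons b w ihw =>
      simp only [List.nil_append, harmonicWord_nil_left] at ihw
      simp only [List.nil_append, List.cons_append, harmonicWord_cons, ihw, harmonicWord_nil_left,
        zWord_cons, zWord_concat, mul_add, add_mul, mul_assoc]
      abel
  | cons a v ihv =>
    induction w with
    | nil =>
      have ih := ihv []
      simp only [List.nil_append, harmonicWord_nil_right] at ih
      simp only [List.nil_append, List.cons_append, harmonicWord_cons, ih, harmonicWord_nil_right,
        zWord_cons, zWord_concat, mul_add, add_mul, mul_assoc]
      abel
    | cons b w ihw =>
      have ih := ihv (b :: w)
      simp only [List.cons_append] at ih ihw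
      simp only [List.cons_append, harmonicWord_cons, ih, ihw, ihv w, mul_add, add_mul,
        mul_assoc]
      abel

theorem H1_induction {p : (a : NCPoly) → a ∈ H1 → Prop}
    (word : ∀ k : List ℕ+, p (zWord k) (zWord_mem_H1 k))
    (add : ∀ a b ha hb, p a ha → p b hb → p (a + b) (add_mem ha hb))
    (smul : ∀ (c : ℚ) a ha, p a ha → p (c • a) (H1.smul_mem c ha)) {a : NCPoly}
    (ha : a ∈ H1) : p a ha := by
  induction ha using Submodule.span_induction with
  | mem _ h =>
    obtain ⟨v, rfl⟩ := h
    exact word v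
  | zero => simpa using smul 0 _ _ (word [])
  | add a b _ _ ha hb => exact add a b _ _ ha hb
  | smul c a _ ha => exact smul c a _ ha

theorem z_mul_mem_H1 (p : ℕ+) {a : NCPoly} (ha : a ∈ H1) : z p * a ∈ H1 := by
  induction ha using H1_induction with
  | word k => rw [← zWord_cons]; exact zWord_mem_H1 _
  | add a b _ _ ha hb => rw [mul_add]; exact add_mem ha hb
  | smul c a _ ha => rw [mul_smul_comm]; exact H1.smul_mem c ha

theorem harmonicWord_mem_H1 (v w : List ℕ+) : harmonicWord v w ∈ H1 := by
  induction v generalizing w with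
  | nil => simpa using zWord_mem_H1 w
  | cons p v ihv =>
    induction w with
    | nil => simpa using zWord_mem_H1 _
    | cons q w ihw =>
      rw [harmonicWord_cons]
      exact add_mem (add_mem (z_mul_mem_H1 _ (ihv _)) (z_mul_mem_H1 _ ihw)) (z_mul_mem_H1 _ (ihv _))

theorem harmonicProd_one_left {a : NCPoly} (ha : a ∈ H1) : harmonicProd 1 a = a := by
  induction ha using H1_induction with
  | word k => rw [← zWord_nil, harmonicProd_zWord, harmonicWord_nil_left]
  | add a b _ _ ha hb => rw [map_add, ha, hb]
  | smul c a _ ha => rw [map_smul, ha]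

theorem harmonicProd_one_right {a : NCPoly} (ha : a ∈ H1) : harmonicProd a 1 = a := by
  induction ha using H1_induction with
  | word k => rw [← zWord_nil, harmonicProd_zWord, harmonicWord_nil_right]
  | add a b _ _ ha hb => rw [map_add, LinearMap.add_apply, ha, hb]
  | smul c a _ ha => rw [map_smul, LinearMap.smul_apply, ha]

theorem harmonicProd_z_mul_left (p r : ℕ+) {a : NCPoly} (ha : a ∈ H1) (c : List ℕ+) :
    harmonicProd (z p * a) (zWord (r :: c)) =
      z p * harmonicProd a (zWord (r :: c)) + z r * harmonicProd (z p * a) (zWord c)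
        + z (p + r) * harmonicProd a (zWord c) := by
  induction ha using H1_induction with
  | word k => simp only [← zWord_cons, harmonicProd_zWord, harmonicWord_cons]
  | add a b _ _ ha hb =>
    simp only [mul_add, map_add, LinearMap.add_apply, ha, hb]
    abel
  | smul c a _ ha =>
    simp only [mul_smul_comm, map_smul, LinearMap.smul_apply, ha, smul_add]

theorem harmonicProd_z_mul_right (p r : ℕ+) {a : NCPoly} (ha : a ∈ H1) (c : List ℕ+) :
    harmonicProd (zWord (r :: c)) (z p * a) =
      z r * harmonicProd (zWord c) (z p * a) + z p * harmonicProd (zWord (r :: c)) a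
        + z (r + p) * harmonicProd (zWord c) a := by
  induction ha using H1_induction with
  | word k => simp only [← zWord_cons, harmonicProd_zWord, harmonicWord_cons]
  | add a b _ _ ha hb =>
    simp only [mul_add, map_add, ha, hb]
    abel
  | smul c a _ ha =>
    simp only [mul_smul_comm, map_smul, ha, smul_add]

/-- Associativity of the harmonic product, by expanding both sides by their first factors. -/
theorem harmonicProd_harmonicWord_assoc (a b c : List ℕ+) :
    harmonicProd (harmonicWord a b) (zWord c) = harmonicProd (zWord a) (harmonicWord b c) := by
  induction a generalizing b c with
  | nil =>
    rw [harmonicWord_nil_left, zWord_nil, harmonicProd_one_left (harmonicWord_mem_H1 _ _),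
      harmonicProd_zWord]
  | cons p a iha =>
    induction b generalizing c with
    | nil => rw [harmonicWord_nil_left, harmonicWord_nil_right]
    | cons q b ihb =>
      induction c with
      | nil =>
        rw [harmonicWord_nil_right, zWord_nil, harmonicProd_one_right (harmonicWord_mem_H1 _ _),
          harmonicProd_zWord]
      | cons r c ihc =>
        have h₁ : harmonicProd (harmonicWord (p :: a) (q :: b)) (zWord (r :: c)) =
            z p * harmonicProd (harmonicWord a (q :: b)) (zWord (r :: c))
            + z q * harmonicProd (harmonicWord (p :: a) b) (zWord (r :: c))
            + z (p + q) * harmonicProd (harmonicWord a b) (zWord (r :: c))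
            + z r * harmonicProd (harmonicWord (p :: a) (q :: b)) (zWord c)
            + z (p + r) * harmonicProd (harmonicWord a (q :: b)) (zWord c)
            + z (q + r) * harmonicProd (harmonicWord (p :: a) b) (zWord c)
            + z (p + q + r) * harmonicProd (harmonicWord a b) (zWord c) := by
          rw [harmonicWord_cons p q a b]
          simp only [map_add, LinearMap.add_apply, harmonicProd_z_mul_left _ _
            (harmonicWord_mem_H1 _ _), mul_add]
          abel
        have h₂ : harmonicProd (zWord (p :: a)) (harmonicWord (q :: b) (r :: c)) =
            z p * harmonicProd (zWord a) (harmonicWord (q :: b) (r :: c))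
            + z q * harmonicProd (zWord (p :: a)) (harmonicWord b (r :: c))
            + z (p + q) * harmonicProd (zWord a) (harmonicWord b (r :: c))
            + z r * harmonicProd (zWord (p :: a)) (harmonicWord (q :: b) c)
            + z (p + r) * harmonicProd (zWord a) (harmonicWord (q :: b) c)
            + z (q + r) * harmonicProd (zWord (p :: a)) (harmonicWord b c)
            + z (p + q + r) * harmonicProd (zWord a) (harmonicWord b c) := by
          rw [harmonicWord_cons q r b c]
          simp only [map_add, harmonicProd_z_mul_right _ _ (harmonicWord_mem_H1 _ _), mul_add,
            ← add_assoc]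
          abel
        rw [h₁, h₂, iha, ihb, iha, ihc, iha, ihb, iha]

theorem harmonicProd_mem_Hy {a b : NCPoly} (ha : a ∈ Hy) (hb : b ∈ H1) :
    harmonicProd a b ∈ Hy := by
  induction ha using Hy_induction with
  | add a a' _ _ h h' => rw [map_add]; exact add_mem h h'
  | smul c a _ h => rw [map_smul]; exact Hy.smul_mem c h
  | word k p =>
    induction hb using H1_induction with
    | add a a' _ _ h h' => rw [map_add]; exact add_mem h h'
    | smul c a _ h => rw [map_smul]; exact Hy.smul_mem c h
    | word l =>
      rw [harmonicProd_zWord]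
      induction l using List.reverseRecOn with
      | nil => rw [harmonicWord_nil_right, zWord_concat]; exact mul_z_mem_Hy _ _
      | append_singleton l q _ =>
        rw [harmonicWord_concat]
        exact add_mem (add_mem (mul_z_mem_Hy _ _) (mul_z_mem_Hy _ _)) (mul_z_mem_Hy _ _)

theorem circledast_y {a : NCPoly} (ha : a ∈ Hy) : circledast a y = x * a := by
  induction ha using Hy_induction with
  | add a b _ _ ha hb => rw [map_add, LinearMap.add_apply, ha, hb, mul_add]
  | smul c a _ ha => rw [map_smul, LinearMap.smul_apply, ha, mul_smul_comm]
  | word k p =>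
    have hy : y = zWord [1] := by simp [zWord_cons, z_one]
    obtain ⟨q, l, h⟩ : ∃ q l, k ++ [p] = q :: l := by
      cases k
      · exact ⟨p, [], rfl⟩
      · exact ⟨_, _, rfl⟩
    rw [h]
    nth_rw 1 [hy]
    rw [circledast_zWord, circledastWord, harmonicWord_nil_right, zWord_cons, ← mul_assoc, x_mul_z]

/-! ### The action of the harmonic algebra on `𝔥` -/

/-- Auxiliary to `trailing`; `n` counts the letters `x` read since the last `y`. -/
def trailingAux : ℕ → List Letter → ℕ
  | n, [] => n
  | n, Letter.x :: w => trailingAux (n + 1) w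
  | _, Letter.y :: w => trailingAux 0 w

/-- The number of letters `x` at the very end of a word. -/
def trailing (w : FreeMonoid Letter) : ℕ := trailingAux 0 w.toList

theorem toList_of_x_pow (m : ℕ) :
    (FreeMonoid.of Letter.x ^ m).toList = List.replicate m Letter.x := by
  induction m with
  | zero => rfl
  | succ m ih =>
    rw [pow_succ', FreeMonoid.toList_mul, ih, FreeMonoid.toList_of, List.replicate_succ]
    rfl

theorem trailingAux_replicate (n m : ℕ) (w : List Letter) :
    trailingAux n (List.replicate m Letter.x ++ w) = trailingAux (n + m) w := by
  induction m generalizing n with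
  | zero => rfl
  | succ m ih =>
    rw [List.replicate_succ, List.cons_append, trailingAux, ih, Nat.add_right_comm, Nat.add_assoc]

theorem toList_zWordFM_cons_mul (p : ℕ+) (k : List ℕ+) (n : ℕ) :
    (zWordFM (p :: k) * FreeMonoid.of Letter.x ^ n).toList =
      List.replicate ((p : ℕ) - 1) Letter.x ++
        Letter.y :: (zWordFM k * FreeMonoid.of Letter.x ^ n).toList := by
  simp [zWordFM, FreeMonoid.toList_mul, toList_of_x_pow]

theorem indices_zWordFM_mul (k : List ℕ+) (n : ℕ) :
    indices (zWordFM k * FreeMonoid.of Letter.x ^ n) = k := by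
  rw [indices]
  induction k with
  | nil =>
    have := indicesAux_replicate 0 n []
    simpa [zWordFM, toList_of_x_pow, indicesAux] using this
  | cons p k ih =>
    rw [toList_zWordFM_cons_mul, indicesAux_replicate, indicesAux, ih]
    congr 1
    apply PNat.eq
    have := p.pos
    simp only [Nat.succPNat_coe]
    omega

theorem trailing_zWordFM_mul (k : List ℕ+) (n : ℕ) :
    trailing (zWordFM k * FreeMonoid.of Letter.x ^ n) = n := by
  rw [trailing]
  induction k with
  | nil =>
    have := trailingAux_replicate 0 n []
    simpa [zWordFM, toList_of_x_pow, trailingAux] using this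
  | cons p k ih => rw [toList_zWordFM_cons_mul, trailingAux_replicate, trailingAux, ih]

theorem bilinExt_word (g : FreeMonoid Letter → FreeMonoid Letter → NCPoly) (k l : List ℕ+)
    (m n : ℕ) : bilinExt g (zWord k * x ^ m) (zWord l * x ^ n) =
      g (zWordFM k * FreeMonoid.of Letter.x ^ m) (zWordFM l * FreeMonoid.of Letter.x ^ n) := by
  have h : ∀ (k : List ℕ+) (m : ℕ), zWord k * x ^ m =
      FreeAlgebra.basisFreeMonoid ℚ Letter (zWordFM k * FreeMonoid.of Letter.x ^ m) := by
    intro k m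
    rw [← basisFreeMonoid_zWordFM, basisFreeMonoid_apply, basisFreeMonoid_apply, map_mul, map_pow,
      FreeMonoid.lift_eval_of]
    rfl
  rw [h, h, bilinExt, Module.Basis.constr_basis, Module.Basis.constr_basis]

/-- The action of `𝔥¹` on `𝔥` that extends the harmonic product by
`a · (w xⁿ) = (a ∗ w) xⁿ` for `w ∈ 𝔥¹`. -/
def act : NCPoly →ₗ[ℚ] Module.End ℚ NCPoly :=
  bilinExt fun v w => harmonicWord (indices v) (indices w) * x ^ trailing w

/-- As for `harmonicProd`, letters `x` at the end of the acting word are ignored. -/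
theorem act_word (k l : List ℕ+) (m n : ℕ) :
    act (zWord k * x ^ m) (zWord l * x ^ n) = harmonicWord k l * x ^ n := by
  rw [act, bilinExt_word, indices_zWordFM_mul, indices_zWordFM_mul, trailing_zWordFM_mul]

theorem act_zWord (k l : List ℕ+) (n : ℕ) :
    act (zWord k) (zWord l * x ^ n) = harmonicWord k l * x ^ n := by
  simpa using act_word k l 0 n

theorem act_zWord_zWord (k l : List ℕ+) : act (zWord k) (zWord l) = harmonicWord k l := by
  simpa using act_word k l 0 0

theorem harmonicProd_word (k l : List ℕ+) (m n : ℕ) :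
    harmonicProd (zWord k * x ^ m) (zWord l * x ^ n) = harmonicWord k l := by
  rw [harmonicProd, bilinExt_word, indices_zWordFM_mul, indices_zWordFM_mul]

theorem act_mul_x (a w : NCPoly) : act a (w * x) = act a w * x := by
  induction a using induction_zWord with
  | add a b ha hb => rw [map_add, LinearMap.add_apply, LinearMap.add_apply, ha, hb, add_mul]
  | smul c a ha => rw [map_smul, LinearMap.smul_apply, LinearMap.smul_apply, ha, smul_mul_assoc]
  | word k m =>
    induction w using induction_zWord with
    | add a b ha hb => rw [add_mul, map_add, map_add, ha, hb, add_mul]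
    | smul c a ha => rw [smul_mul_assoc, map_smul, map_smul, ha, smul_mul_assoc]
    | word l n => rw [mul_assoc, ← pow_succ, act_word, act_word, mul_assoc, ← pow_succ]

theorem act_of_mem_H1 (a : NCPoly) {w : NCPoly} (hw : w ∈ H1) : act a w = harmonicProd a w := by
  induction a using induction_zWord with
  | add a b ha hb => simp only [map_add, LinearMap.add_apply, ha, hb]
  | smul c a ha => simp only [map_smul, LinearMap.smul_apply, ha]
  | word k m =>
    induction hw using H1_induction with
    | add a b _ _ ha hb => rw [map_add, map_add, ha, hb]
    | smul c a _ ha => rw [map_smul, map_smul, ha]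
    | word l =>
      have h₁ := act_word k l m 0
      have h₂ := harmonicProd_word k l m 0
      rw [pow_zero, mul_one] at h₁ h₂
      rw [h₁, h₂, mul_one]

theorem act_mul_x_pow (a w : NCPoly) (n : ℕ) : act a (w * x ^ n) = act a w * x ^ n := by
  induction n with
  | zero => simp
  | succ n ih => rw [pow_succ, ← mul_assoc, act_mul_x, ih, mul_assoc]

theorem act_mul (a b : NCPoly) : act a * act b = act (harmonicProd a b) := by
  apply LinearMap.ext
  intro w
  rw [Module.End.mul_apply]
  induction a using induction_zWord with
  | add a b ha hb => simp only [map_add, LinearMap.add_apply, ha, hb]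
  | smul c a ha => simp only [map_smul, LinearMap.smul_apply, ha]
  | word k m =>
    induction b using induction_zWord with
    | add a b ha hb => simp only [map_add, LinearMap.add_apply, ha, hb]
    | smul c a ha => simp only [map_smul, LinearMap.smul_apply, ha]
    | word l n =>
      induction w using induction_zWord with
      | add a b ha hb => simp only [map_add, ha, hb]
      | smul c a ha => simp only [map_smul, ha]
      | word r i =>
        have e : act (zWord k * x ^ m) = act (zWord k) := by
          apply LinearMap.ext
          intro u
          induction u using induction_zWord with
          | add a b ha hb => simp only [map_add, ha, hb]
          | smul c a ha => simp only [map_smul, ha]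
          | word s j => rw [act_word, act_zWord]
        rw [e, act_word, harmonicProd_word, act_mul_x_pow, act_mul_x_pow,
          act_of_mem_H1 _ (zWord_mem_H1 _), act_of_mem_H1 _ (harmonicWord_mem_H1 _ _),
          harmonicProd_harmonicWord_assoc]

theorem harmonicProd_comm (a b : NCPoly) : harmonicProd a b = harmonicProd b a := by
  induction a using induction_zWord with
  | add a b ha hb => simp only [map_add, LinearMap.add_apply, ha, hb]
  | smul c a ha => simp only [map_smul, LinearMap.smul_apply, ha]
  | word k m =>
    induction b using induction_zWord with
    | add a b ha hb => simp only [map_add, LinearMap.add_apply, ha, hb]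
    | smul c a ha => simp only [map_smul, LinearMap.smul_apply, ha]
    | word l n => rw [harmonicProd_word, harmonicProd_word, harmonicWord_comm]

theorem harmonicProd_mem_H1 {a b : NCPoly} (ha : a ∈ H1) (hb : b ∈ H1) :
    harmonicProd a b ∈ H1 := by
  induction ha using H1_induction with
  | add a a' _ _ h h' => rw [map_add]; exact add_mem h h'
  | smul c a _ h => rw [map_smul]; exact H1.smul_mem c h
  | word k =>
    induction hb using H1_induction with
    | add a a' _ _ h h' => rw [map_add]; exact add_mem h h'
    | smul c a _ h => rw [map_smul]; exact H1.smul_mem c h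
    | word l =>
      rw [harmonicProd_zWord]
      exact harmonicWord_mem_H1 k l

theorem act_one : act 1 = 1 := by
  apply LinearMap.ext
  intro w
  induction w using induction_zWord with
  | add a b ha hb => rw [map_add, ha, hb, map_add]
  | smul c a ha => rw [map_smul, ha, map_smul]
  | word k m => rw [← zWord_nil, act_zWord, harmonicWord_nil_left, Module.End.one_apply]

theorem act_apply_one {a : NCPoly} (ha : a ∈ H1) : act a 1 = a := by
  have h : (1 : NCPoly) ∈ H1 := zWord_mem_H1 []
  rw [act_of_mem_H1 a h, harmonicProd_one_right ha]

/-! ### The operation on `𝔥` that corresponds to grafting -/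

/-- The linear map `Λ` on `𝔥` with `1 ↦ -y`, `w x ↦ -2 w x y` and `w y ↦ w (x - y) y`. On `𝔥 y`
it is the conjugate of `v y ↦ v (x + 2 y) y` by `φ`; the other values are the ones for which
`Λ(v (x + y) w) = v (x + y) Λ(w)` holds throughout, see `graftOp_mul`. -/
def graftOp : NCPoly →ₗ[ℚ] NCPoly :=
  LinearMap.mulRight ℚ ((x - y) * y) ∘ₗ lastCoeff Letter.y
    - LinearMap.mulRight ℚ (2 * x * y) ∘ₗ lastCoeff Letter.x
    - constCoeff.toLinearMap.smulRight y

@[simp] theorem graftOp_one : graftOp 1 = -y := by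
  simp [graftOp]

@[simp] theorem graftOp_mul_x (w : NCPoly) : graftOp (w * x) = -(2 * w * x * y) := by
  simp [graftOp, mul_assoc, two_mul, mul_add, add_mul]

@[simp] theorem graftOp_mul_y (w : NCPoly) : graftOp (w * y) = w * (x - y) * y := by
  simp [graftOp, mul_assoc]

theorem graftOp_mem_Hy (w : NCPoly) : graftOp w ∈ Hy := by
  rw [mem_Hy]
  refine ⟨lastCoeff Letter.y w * (x - y) - lastCoeff Letter.x w * (2 * x)
    - algebraMap ℚ NCPoly (constCoeff w), ?_⟩
  simp [graftOp, sub_mul, mul_assoc, Algebra.smul_def]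

theorem graftOp_mul (v w : NCPoly) : graftOp (v * ((x + y) * w)) = v * ((x + y) * graftOp w) := by
  induction w using induction_right with
  | one =>
    rw [mul_one, mul_add, map_add, graftOp_mul_x, graftOp_mul_y, graftOp_one]
    noncomm_ring
  | mul_x w _ =>
    rw [← mul_assoc, ← mul_assoc, graftOp_mul_x, graftOp_mul_x]
    noncomm_ring
  | mul_y w _ =>
    rw [← mul_assoc, ← mul_assoc, graftOp_mul_y, graftOp_mul_y]
    noncomm_ring
  | add a b ha hb => simp only [mul_add, map_add] at ha hb ⊢; rw [ha, hb]
  | smul c a ha => simp only [mul_smul_comm, map_smul, ha]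

theorem graftOp_mul_z (w : NCPoly) (p : ℕ+) :
    graftOp (w * z p) = w * z (p + 1) - w * z p * z 1 := by
  rw [← x_mul_z, z, ← mul_assoc, graftOp_mul_y, z_one, ← mul_assoc x, ← pow_succ', pow_succ]
  noncomm_ring

/-- The right recursion of the action of `Λ(a)`, which comes from comparing the recursions of
`Λ(a) ∗ w` and of `a ∗ w` that split off the last factors. -/
theorem act_graftOp_mul_y {a : NCPoly} (ha : a ∈ H1) (w : NCPoly) :
    act (graftOp a) (w * y) =
      act (graftOp a) w * y + graftOp (act a (w * y)) - 2 * act a w * x * y := by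
  induction ha using H1_induction with
  | add a b _ _ ha hb =>
    simp only [map_add, LinearMap.add_apply, ha, hb, add_mul, mul_add]
    abel
  | smul c a _ ha =>
    simp only [map_smul, LinearMap.smul_apply, ha, smul_mul_assoc, mul_smul_comm, smul_add,
      smul_sub]
  | word k =>
    induction w using induction_zWord with
    | add a b ha hb =>
      simp only [map_add, ha, hb, add_mul, mul_add]
      abel
    | smul c a ha =>
      simp only [map_smul, ha, smul_mul_assoc, mul_smul_comm, smul_add, smul_sub]
    | word l n =>
      have hz : x ^ n * y = z n.succPNat := (z_succPNat n).symm
      have hz' : x ^ n * (x * y) = z (n.succPNat + 1) := by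
        rw [← x_mul_z, z_succPNat, ← mul_assoc, ← mul_assoc, ← pow_succ, ← pow_succ']
      have hw : zWord l * x ^ n * y = zWord (l ++ [n.succPNat]) := by
        rw [zWord_concat, mul_assoc, hz]
      rw [hw]
      generalize n.succPNat = q at hz hz'
      induction k using List.reverseRecOn with
      | nil =>
        have hy : y = zWord ([] ++ [1]) := by simp [zWord_cons, z_one]
        rw [zWord_nil, graftOp_one, act_one, map_neg, LinearMap.neg_apply, LinearMap.neg_apply]
        nth_rw 1 [hy]
        nth_rw 1 [hy]
        rw [act_zWord_zWord, act_zWord, harmonicWord_concat, Module.End.one_apply,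
          Module.End.one_apply, zWord_concat, graftOp_mul_z, harmonicWord_nil_left, zWord_concat,
          harmonicWord_nil_left, add_comm 1 q]
        simp only [mul_assoc, neg_mul, hz, hz']
        noncomm_ring
      | append_singleton k p _ =>
        have hg : graftOp (zWord (k ++ [p])) =
            zWord (k ++ [p + 1]) - zWord ((k ++ [p]) ++ [1]) := by
          rw [zWord_concat, graftOp_mul_z, ← zWord_concat, ← zWord_concat, ← zWord_concat]
        rw [hg, map_sub, LinearMap.sub_apply, LinearMap.sub_apply]
        simp only [act_zWord_zWord, act_zWord]
        rw [harmonicWord_concat (p + 1), harmonicWord_concat 1, harmonicWord_concat p q k l]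
        simp only [map_add, graftOp_mul_z, sub_mul, mul_assoc, hz, hz']
        rw [add_right_comm p 1 q, add_comm 1 q]
        noncomm_ring

/-! ### Recursion on rooted trees -/

/-- Auxiliary to `treeRec`, on planar representatives. -/
def treeRecPlanar {R : Type*} [CommMonoid R] (L : R → R) : PlanarTree → R
  | PlanarTree.node l => L (l.attach.map fun t => treeRecPlanar L t.1).prod
termination_by t => sizeOf t
decreasing_by
  have := List.sizeOf_lt_of_mem t.2
  simp only [PlanarTree.node.sizeOf_spec]
  omega

theorem treeRecPlanar_node {R : Type*} [CommMonoid R] (L : R → R) (l : List PlanarTree) :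
    treeRecPlanar L (PlanarTree.node l) = L (l.map (treeRecPlanar L)).prod := by
  rw [treeRecPlanar, List.attach_map_val (f := treeRecPlanar L)]

theorem treeRecPlanar_step {R : Type*} [CommMonoid R] (L : R → R) {s t : PlanarTree}
    (h : PlanarTree.Step s t) : treeRecPlanar L s = treeRecPlanar L t := by
  induction h with
  | perm h => rw [treeRecPlanar_node, treeRecPlanar_node, (h.map (treeRecPlanar L)).prod_eq]
  | branch l₁ l₂ h ih =>
    rw [treeRecPlanar_node, treeRecPlanar_node]
    simp only [List.map_append, List.map_cons, ih]

/-- The function `ψ` from rooted trees to a commutative monoid with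
`ψ(B₊(t₁ ⋯ tₙ)) = L(ψ(t₁) ⋯ ψ(tₙ))`. -/
def treeRec {R : Type*} [CommMonoid R] (L : R → R) : RootedTree → R :=
  Quot.lift (treeRecPlanar L) fun _ _ h => treeRecPlanar_step L h

theorem exists_map_mk_eq (s : Multiset RootedTree) :
    ∃ l : List PlanarTree, (l.map RootedTree.mk : List RootedTree) = s := by
  induction s using Quotient.inductionOn with
  | h l =>
    refine ⟨l.map RootedTree.out, ?_⟩
    simp [RootedTree.mk_out, Function.comp_def]

theorem treeRec_graft {R : Type*} [CommMonoid R] (L : R → R) (s : Multiset RootedTree) :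
    treeRec L (graft s) = L (s.map (treeRec L)).prod := by
  obtain ⟨l, rfl⟩ := exists_map_mk_eq s
  rw [graft_map_mk]
  simp only [Multiset.map_coe, List.map_map, Multiset.prod_coe]
  exact treeRecPlanar_node L l

theorem exists_graft_eq (t : RootedTree) : ∃ s, graft s = t := by
  obtain ⟨⟨l⟩⟩ := t
  exact ⟨_, graft_map_mk l⟩

/-- The number of vertices of a rooted tree. -/
def treeDeg : RootedTree → ℕ :=
  treeRec (R := Multiplicative ℕ) fun n => Multiplicative.ofAdd (n.toAdd + 1)

/-- The number of vertices of a forest. -/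
def deg (s : Multiset RootedTree) : ℕ := (s.map treeDeg).sum

theorem treeDeg_graft (s : Multiset RootedTree) : treeDeg (graft s) = deg s + 1 :=
  treeRec_graft (R := Multiplicative ℕ) _ s

@[simp] theorem deg_zero : deg 0 = 0 := rfl
@[simp] theorem deg_singleton (t : RootedTree) : deg {t} = treeDeg t := by simp [deg]
@[simp] theorem deg_add (s t : Multiset RootedTree) : deg (s + t) = deg s + deg t := by simp [deg]

theorem treeDeg_pos (t : RootedTree) : 0 < treeDeg t := by
  obtain ⟨s, rfl⟩ := exists_graft_eq t
  rw [treeDeg_graft]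
  omega

theorem deg_pos {s : Multiset RootedTree} (hs : s ≠ 0) : 0 < deg s := by
  obtain ⟨t, ht⟩ := Multiset.exists_mem_of_ne_zero hs
  obtain ⟨r, rfl⟩ := Multiset.exists_cons_of_mem ht
  have := treeDeg_pos t
  rw [← Multiset.singleton_add, deg_add, deg_singleton]
  omega

theorem forest_cases (s : Multiset RootedTree) :
    s = 0 ∨ (∃ r, s = {graft r}) ∨ ∃ a b, a ≠ 0 ∧ b ≠ 0 ∧ s = a + b := by
  induction s using Multiset.induction_on with
  | empty => exact Or.inl rfl
  | cons t r _ =>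
    right
    rcases eq_or_ne r 0 with rfl | hr
    · obtain ⟨r, rfl⟩ := exists_graft_eq t
      exact Or.inl ⟨r, rfl⟩
    · exact Or.inr ⟨{t}, r, Multiset.singleton_ne_zero t, hr, (Multiset.singleton_add t r).symm⟩

/-- Every forest arises from the empty one by grafting and by disjoint union. -/
theorem forest_induction {p : Multiset RootedTree → Prop} (zero : p 0)
    (graft : ∀ s, p s → p {graft s}) (add : ∀ s t, s ≠ 0 → t ≠ 0 → p s → p t → p (s + t))
    (s : Multiset RootedTree) : p s := by
  induction h : deg s using Nat.strong_induction_on generalizing s with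
  | _ n ih =>
    subst h
    rcases forest_cases s with rfl | ⟨r, rfl⟩ | ⟨a, b, ha, hb, rfl⟩
    · exact zero
    · exact graft r (ih _ (by rw [deg_singleton, treeDeg_graft]; omega) r rfl)
    · have := deg_pos ha
      have := deg_pos hb
      rw [deg_add] at ih
      exact add a b ha hb (ih _ (by omega) a rfl) (ih _ (by omega) b rfl)

@[simp] theorem forest_zero : forest 0 = 1 := by simp [forest]
@[simp] theorem forest_singleton (t : RootedTree) : forest {t} = tree t := by simp [forest]
@[simp] theorem forest_add (s t : Multiset RootedTree) :
    forest (s + t) = forest s * forest t := by simp [forest]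

theorem span_range_forest : Submodule.span ℚ (Set.range forest) = ⊤ := by
  rw [eq_top_iff, ← (MvPolynomial.basisMonomials RootedTree ℚ).span_eq, Submodule.span_le]
  rintro _ ⟨s, rfl⟩
  apply Submodule.subset_span
  refine ⟨Finsupp.toMultiset s, ?_⟩
  rw [forest_eq_monomial, MvPolynomial.coe_basisMonomials]

/-- The forests span `ℋ`. -/
theorem forestAlg_induction {p : ForestAlg → Prop} (forest : ∀ s, p (forest s))
    (add : ∀ a b, p a → p b → p (a + b)) (smul : ∀ (c : ℚ) a, p a → p (c • a)) (f : ForestAlg) :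
    p f := by
  have hf : f ∈ Submodule.span ℚ (Set.range RootedTreeMaps.forest) := by
    rw [span_range_forest]; trivial
  induction hf using Submodule.span_induction with
  | mem _ h =>
    obtain ⟨s, rfl⟩ := h
    exact forest s
  | zero => simpa using smul 0 _ (forest 0)
  | add a b _ _ ha hb => exact add a b ha hb
  | smul c a _ ha => exact smul c a ha

/-! ### Forests as harmonic multiplication operators -/

theorem act_commute : ∀ a ∈ Set.range act, ∀ b ∈ Set.range act, a * b = b * a := by
  rintro _ ⟨a, rfl⟩ _ ⟨b, rfl⟩
  rw [act_mul, act_mul, harmonicProd_comm]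

/-- The commutative algebra of the operators `w ↦ a ∗ w`. -/
def actAlg : Subalgebra ℚ (Module.End ℚ NCPoly) := Algebra.adjoin ℚ (Set.range act)

instance : IsMulCommutative actAlg := Algebra.isMulCommutative_adjoin ℚ act_commute

open scoped IsMulCommutative in
/-- The algebra homomorphism that sends a forest `f` to the operator `w ↦ G_f ∗ w`, where the
elements `G_f ∈ 𝔥¹` are given by `G_{fg} = G_f ∗ G_g` and `G_{B₊(f)} = Λ(G_f)`. -/
def forestOp : ForestAlg →ₐ[ℚ] Module.End ℚ NCPoly :=
  actAlg.val.comp (MvPolynomial.aeval (treeRec fun c : actAlg =>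
    ⟨act (graftOp (c.1 1)), Algebra.subset_adjoin ⟨_, rfl⟩⟩))

open scoped IsMulCommutative in
theorem forestOp_graft (s : Multiset RootedTree) :
    forestOp (tree (graft s)) = act (graftOp (forestOp (forest s) 1)) := by
  have h : MvPolynomial.aeval (treeRec fun c : actAlg =>
      (⟨act (graftOp (c.1 1)), Algebra.subset_adjoin ⟨_, rfl⟩⟩ : actAlg)) (forest s) =
      (s.map (treeRec fun c : actAlg =>
        (⟨act (graftOp (c.1 1)), Algebra.subset_adjoin ⟨_, rfl⟩⟩ : actAlg))).prod := by
    rw [forest, map_multiset_prod, Multiset.map_map]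
    congr 1
    refine Multiset.map_congr rfl fun t _ => ?_
    simp [tree]
  simp only [forestOp, AlgHom.comp_apply, h]
  rw [tree, MvPolynomial.aeval_X, treeRec_graft]
  rfl

theorem exists_forestOp_eq_act (f : ForestAlg) : ∃ a ∈ H1, forestOp f = act a := by
  induction f using forestAlg_induction with
  | forest s =>
    induction s using forest_induction with
    | zero => exact ⟨1, zWord_mem_H1 [], by rw [forest_zero, map_one, act_one]⟩
    | graft s _ =>
      exact ⟨_, Hy_le_H1 (graftOp_mem_Hy _), by rw [forest_singleton, forestOp_graft]⟩
    | add s t _ _ hs ht =>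
      obtain ⟨a, ha, hs⟩ := hs
      obtain ⟨b, hb, ht⟩ := ht
      refine ⟨act a b, ?_, ?_⟩
      · rw [act_of_mem_H1 a hb]
        exact harmonicProd_mem_H1 ha hb
      · rw [forest_add, map_mul, hs, ht, act_mul, act_of_mem_H1 a hb]
  | add a b ha hb =>
    obtain ⟨a', ha, ha'⟩ := ha
    obtain ⟨b', hb, hb'⟩ := hb
    exact ⟨a' + b', add_mem ha hb, by rw [map_add, map_add, ha', hb']⟩
  | smul c a ha =>
    obtain ⟨a', ha, ha'⟩ := ha
    exact ⟨c • a', H1.smul_mem c ha, by rw [map_smul, map_smul, ha']⟩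

theorem forestOp_one_mem_H1 (f : ForestAlg) : forestOp f 1 ∈ H1 := by
  obtain ⟨a, ha, h⟩ := exists_forestOp_eq_act f
  rwa [h, act_apply_one ha]

theorem forestOp_eq_act (f : ForestAlg) : forestOp f = act (forestOp f 1) := by
  obtain ⟨a, ha, h⟩ := exists_forestOp_eq_act f
  rw [h, act_apply_one ha]

theorem forestOp_mul_x (f : ForestAlg) (w : NCPoly) : forestOp f (w * x) = forestOp f w * x := by
  rw [forestOp_eq_act, act_mul_x]

theorem forestOp_bPlus (f : ForestAlg) : forestOp (bPlus f) = act (graftOp (forestOp f 1)) := by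
  induction f using forestAlg_induction with
  | forest s => rw [bPlus_forest, forestOp_graft]
  | add a b ha hb => simp only [map_add, LinearMap.add_apply, ha, hb]
  | smul c a ha => simp only [map_smul, LinearMap.smul_apply, ha]

theorem forestOp_bPlus_one (f : ForestAlg) : forestOp (bPlus f) 1 = graftOp (forestOp f 1) := by
  rw [forestOp_bPlus, act_apply_one (Hy_le_H1 (graftOp_mem_Hy _))]

theorem forestOp_bPlus_mul_y (f : ForestAlg) (w : NCPoly) :
    forestOp (bPlus f) (w * y) = forestOp (bPlus f) w * y + graftOp (forestOp f (w * y))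
      - 2 * forestOp f w * x * y := by
  rw [forestOp_bPlus, act_graftOp_mul_y (forestOp_one_mem_H1 f), ← forestOp_eq_act]

theorem forestOp_one_mem_Hy {s : Multiset RootedTree} (hs : s ≠ 0) :
    forestOp (forest s) 1 ∈ Hy := by
  induction s using forest_induction with
  | zero => exact absurd rfl hs
  | graft s _ =>
    rw [forest_singleton, ← bPlus_forest, forestOp_bPlus_one]
    exact graftOp_mem_Hy _
  | add s t hs' ht' ihs iht =>
    rw [forest_add, map_mul, Module.End.mul_apply, forestOp_eq_act,
      act_of_mem_H1 _ (forestOp_one_mem_H1 _)]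
    exact harmonicProd_mem_Hy (ihs hs') (forestOp_one_mem_H1 _)

/-! ### The coproduct -/

/-- The linear map `a ⊗ b ↦ α(a) β(b)`. -/
def pair (α β : ForestAlg →ₗ[ℚ] NCPoly) : ForestAlg ⊗[ℚ] ForestAlg →ₗ[ℚ] NCPoly :=
  LinearMap.mul' ℚ NCPoly ∘ₗ TensorProduct.map α β

@[simp] theorem pair_tmul (α β : ForestAlg →ₗ[ℚ] NCPoly) (a b : ForestAlg) :
    pair α β (a ⊗ₜ b) = α a * β b := by
  simp [pair]

theorem tensorAct_eq_pair (ρ : ForestAlg →ₗ[ℚ] Module.End ℚ NCPoly)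
    (D : ForestAlg ⊗[ℚ] ForestAlg) (w u : NCPoly) :
    tensorAct ρ D w u = pair (ρ.flip w) (ρ.flip u) D := by
  induction D using TensorProduct.induction_on with
  | zero => simp [tensorAct]
  | tmul a b => simp [tensorAct]
  | add a b ha hb =>
    rw [map_add, ← ha, ← hb]
    simp [tensorAct]

/-- The linear map `f ↦ A_f(w)`, where `A_f` is `forestOp f`. -/
def evalOp (w : NCPoly) : ForestAlg →ₗ[ℚ] NCPoly := forestOp.toLinearMap.flip w

@[simp] theorem evalOp_apply (w : NCPoly) (f : ForestAlg) : evalOp w f = forestOp f w := rfl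

/-- Multiplicativity of the formula `A_f(w z u) = ∑ A_{f'}(w) z A_{f''}(u)` in `f`. -/
theorem forestOp_pair {f : ForestAlg} {D : ForestAlg ⊗[ℚ] ForestAlg}
    (h : ∀ w u : NCPoly, forestOp f (w * ((x + y) * u)) =
      pair (evalOp w) (LinearMap.mulLeft ℚ (x + y) ∘ₗ evalOp u) D)
    (E : ForestAlg ⊗[ℚ] ForestAlg) (w u : NCPoly) :
    forestOp f (pair (evalOp w) (LinearMap.mulLeft ℚ (x + y) ∘ₗ evalOp u) E) =
      pair (evalOp w) (LinearMap.mulLeft ℚ (x + y) ∘ₗ evalOp u) (D * E) := by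
  induction E using TensorProduct.induction_on with
  | zero => simp
  | add a b ha hb => rw [map_add, map_add, mul_add, map_add, ha, hb]
  | tmul a b =>
    simp only [pair_tmul, LinearMap.comp_apply, LinearMap.mulLeft_apply, evalOp_apply, h]
    clear h
    induction D using TensorProduct.induction_on with
    | zero => simp
    | add D D' h h' => rw [map_add, add_mul, map_add, h, h']
    | tmul c d => simp

/-- The action of a forest on `w (x + y) u` is given by the coproduct. For `B₊(f)` the two sides
satisfy the same recursion in the last letter of `u`, because `Λ` only sees the last letter. -/
theorem forestOp_mul_add_mul (s : Multiset RootedTree) (w u : NCPoly) :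
    forestOp (forest s) (w * ((x + y) * u)) =
      pair (evalOp w) (LinearMap.mulLeft ℚ (x + y) ∘ₗ evalOp u) (coproduct (forest s)) := by
  induction s using forest_induction generalizing w u with
  | zero => simp [Algebra.TensorProduct.one_def]
  | add s t _ _ hs ht =>
    rw [forest_add, map_mul forestOp, Module.End.mul_apply, ht, forestOp_pair hs, map_mul coproduct]
  | graft s ih =>
    rw [forest_singleton, coproduct_tree_graft, map_add, pair_tmul]
    have hmap : ∀ (β : ForestAlg →ₗ[ℚ] NCPoly) (D : ForestAlg ⊗[ℚ] ForestAlg),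
        pair (evalOp w) β (TensorProduct.map LinearMap.id bPlus D) =
          pair (evalOp w) (β ∘ₗ bPlus) D := by
      intro β D
      induction D using TensorProduct.induction_on with
      | zero => simp
      | add a b ha hb => simp only [map_add, ha, hb]
      | tmul a b => simp
    rw [hmap]
    have hone : ∀ u : NCPoly, forestOp 1 u = u := fun u => by rw [map_one, Module.End.one_apply]
    simp only [LinearMap.comp_apply, evalOp_apply, hone, LinearMap.mulLeft_apply]
    have hy := forestOp_bPlus_mul_y (forest s)
    rw [bPlus_forest] at hy
    induction u using induction_right with
    | one =>
      have key : ∀ D, pair (evalOp w)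
          ((LinearMap.mulLeft ℚ (x + y) ∘ₗ evalOp 1) ∘ₗ bPlus) D =
          graftOp (pair (evalOp w) (LinearMap.mulLeft ℚ (x + y) ∘ₗ evalOp 1) D) := by
        intro D
        induction D using TensorProduct.induction_on with
        | zero => simp
        | add a b ha hb => simp only [map_add, ha, hb]
        | tmul a b =>
          simp only [pair_tmul, LinearMap.comp_apply, LinearMap.mulLeft_apply, evalOp_apply,
            graftOp_mul, forestOp_bPlus_one]
      rw [key, ← ih, mul_one, mul_add, map_add, map_add, map_add, forestOp_mul_x, forestOp_mul_x, hy,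
        graftOp_mul_x]
      noncomm_ring
    | mul_x u ihu =>
      have key : ∀ D, pair (evalOp w)
          ((LinearMap.mulLeft ℚ (x + y) ∘ₗ evalOp (u * x)) ∘ₗ bPlus) D =
          pair (evalOp w) ((LinearMap.mulLeft ℚ (x + y) ∘ₗ evalOp u) ∘ₗ bPlus) D * x := by
        intro D
        induction D using TensorProduct.induction_on with
        | zero => simp
        | add a b ha hb => simp only [map_add, ha, hb, add_mul]
        | tmul a b =>
          simp only [pair_tmul, LinearMap.comp_apply, LinearMap.mulLeft_apply, evalOp_apply,
            forestOp_mul_x, mul_assoc]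
      rw [key, ← mul_assoc, ← mul_assoc, forestOp_mul_x, mul_assoc w, ihu, add_mul]
      simp only [mul_assoc]
    | mul_y u ihu =>
      have key : ∀ D, pair (evalOp w)
          ((LinearMap.mulLeft ℚ (x + y) ∘ₗ evalOp (u * y)) ∘ₗ bPlus) D =
          pair (evalOp w) ((LinearMap.mulLeft ℚ (x + y) ∘ₗ evalOp u) ∘ₗ bPlus) D * y
          + graftOp (pair (evalOp w) (LinearMap.mulLeft ℚ (x + y) ∘ₗ evalOp (u * y)) D)
          - 2 * pair (evalOp w) (LinearMap.mulLeft ℚ (x + y) ∘ₗ evalOp u) D * x * y := by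
        intro D
        induction D using TensorProduct.induction_on with
        | zero => simp
        | add a b ha hb =>
          simp only [map_add, ha, hb, add_mul, mul_add]
          abel
        | tmul a b =>
          simp only [pair_tmul, LinearMap.comp_apply, LinearMap.mulLeft_apply, evalOp_apply,
            forestOp_bPlus_mul_y, graftOp_mul]
          noncomm_ring
      rw [key, ← ih, ← ih, ← mul_assoc, ← mul_assoc, hy, mul_assoc w, ihu]
      noncomm_ring
    | add a b ha hb =>
      have key : ∀ D, pair (evalOp w)
          ((LinearMap.mulLeft ℚ (x + y) ∘ₗ evalOp (a + b)) ∘ₗ bPlus) D =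
          pair (evalOp w) ((LinearMap.mulLeft ℚ (x + y) ∘ₗ evalOp a) ∘ₗ bPlus) D
          + pair (evalOp w) ((LinearMap.mulLeft ℚ (x + y) ∘ₗ evalOp b) ∘ₗ bPlus) D := by
        intro D
        induction D using TensorProduct.induction_on with
        | zero => simp
        | add a b ha hb =>
          simp only [map_add, ha, hb]
          abel
        | tmul a b => simp [mul_add]
      rw [key, mul_add, mul_add, map_add, ha, hb]
      simp only [mul_add]
      abel
    | smul c a ha =>
      have key : ∀ D, pair (evalOp w)
          ((LinearMap.mulLeft ℚ (x + y) ∘ₗ evalOp (c • a)) ∘ₗ bPlus) D =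
          c • pair (evalOp w) ((LinearMap.mulLeft ℚ (x + y) ∘ₗ evalOp a) ∘ₗ bPlus) D := by
        intro D
        induction D using TensorProduct.induction_on with
        | zero => simp
        | add a b ha hb => simp only [map_add, ha, hb, smul_add]
        | tmul a b => simp
      rw [key, mul_smul_comm, mul_smul_comm, map_smul, ha]
      simp only [mul_smul_comm, smul_add]

/-! ### The counit of the coproduct -/

/-- The counit of `ℋ`, which kills all non-empty forests. -/
def counit : ForestAlg →ₐ[ℚ] ℚ := MvPolynomial.aeval fun _ => 0

@[simp] theorem counit_tree (t : RootedTree) : counit (tree t) = 0 := by simp [counit, tree]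

theorem counit_forest {s : Multiset RootedTree} (hs : s ≠ 0) : counit (forest s) = 0 := by
  obtain ⟨t, ht⟩ := Multiset.exists_mem_of_ne_zero hs
  obtain ⟨r, rfl⟩ := Multiset.exists_cons_of_mem ht
  rw [← Multiset.singleton_add, forest_add, forest_singleton, map_mul, counit_tree, zero_mul]

@[simp] theorem counit_bPlus (f : ForestAlg) : counit (bPlus f) = 0 := by
  induction f using forestAlg_induction with
  | forest s => rw [bPlus_forest, counit_tree]
  | add a b ha hb => rw [map_add, map_add, ha, hb, add_zero]
  | smul c a ha => rw [map_smul, map_smul, ha, smul_zero]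

/-- The algebra homomorphism `a ⊗ b ↦ ε(a) b`, where `ε` is the counit. -/
def counitLeft : ForestAlg ⊗[ℚ] ForestAlg →ₐ[ℚ] ForestAlg :=
  Algebra.TensorProduct.lift ((Algebra.ofId ℚ ForestAlg).comp counit) (AlgHom.id ℚ ForestAlg)
    fun _ _ => Commute.all _ _

/-- The algebra homomorphism `a ⊗ b ↦ a ε(b)`, where `ε` is the counit. -/
def counitRight : ForestAlg ⊗[ℚ] ForestAlg →ₐ[ℚ] ForestAlg :=
  Algebra.TensorProduct.lift (AlgHom.id ℚ ForestAlg) ((Algebra.ofId ℚ ForestAlg).comp counit)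
    fun _ _ => Commute.all _ _

theorem counitLeft_tmul (a b : ForestAlg) : counitLeft (a ⊗ₜ b) = counit a • b := by
  simp [counitLeft, Algebra.ofId_apply, Algebra.smul_def]

theorem counitRight_tmul (a b : ForestAlg) : counitRight (a ⊗ₜ b) = counit b • a := by
  simp [counitRight, Algebra.ofId_apply, Algebra.smul_def, mul_comm]

theorem counitLeft_coproduct (s : Multiset RootedTree) :
    counitLeft (coproduct (forest s)) = forest s := by
  have h : ∀ D, counitLeft (TensorProduct.map LinearMap.id bPlus D) = bPlus (counitLeft D) := by
    intro D
    induction D using TensorProduct.induction_on with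
    | zero => simp
    | add a b ha hb => simp only [map_add, ha, hb]
    | tmul a b => simp [counitLeft_tmul]
  induction s using forest_induction with
  | zero => simp
  | add s t _ _ hs ht => rw [forest_add, map_mul, map_mul, hs, ht]
  | graft s hs =>
    rw [forest_singleton, coproduct_tree_graft, map_add, counitLeft_tmul, counit_tree, zero_smul,
      zero_add, h, hs, bPlus_forest]

theorem counitRight_coproduct (s : Multiset RootedTree) :
    counitRight (coproduct (forest s)) = forest s := by
  have h : ∀ D, counitRight (TensorProduct.map LinearMap.id bPlus D) = 0 := by
    intro D
    induction D using TensorProduct.induction_on with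
    | zero => simp
    | add a b ha hb => rw [map_add, map_add, ha, hb, add_zero]
    | tmul a b => simp [counitRight_tmul]
  induction s using forest_induction with
  | zero => simp
  | add s t _ _ hs ht => rw [forest_add, map_mul, map_mul, hs, ht]
  | graft s hs =>
    rw [forest_singleton, coproduct_tree_graft, map_add, counitRight_tmul, map_one, one_smul, h,
      add_zero]

theorem pair_counit_left (c : NCPoly) (β : ForestAlg →ₗ[ℚ] NCPoly) (s : Multiset RootedTree) :
    pair (counit.toLinearMap.smulRight c) β (coproduct (forest s)) = c * β (forest s) := by
  have h : ∀ D, pair (counit.toLinearMap.smulRight c) β D = c * β (counitLeft D) := by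
    intro D
    induction D using TensorProduct.induction_on with
    | zero => simp
    | add a b ha hb => simp only [map_add, mul_add, ha, hb]
    | tmul a b => simp [counitLeft_tmul]
  rw [h, counitLeft_coproduct]

theorem pair_counit_right (c : NCPoly) (α : ForestAlg →ₗ[ℚ] NCPoly) (s : Multiset RootedTree) :
    pair α (counit.toLinearMap.smulRight c) (coproduct (forest s)) = α (forest s) * c := by
  have h : ∀ D, pair α (counit.toLinearMap.smulRight c) D = α (counitRight D) * c := by
    intro D
    induction D using TensorProduct.induction_on with
    | zero => simp
    | add a b ha hb => simp only [map_add, add_mul, ha, hb]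
    | tmul a b => simp [counitRight_tmul]
  rw [h, counitRight_coproduct]

/-! ### Construction of the rooted tree maps -/

/-- The conjugates by `φ` of the operators `forestOp f`, as a map `f ↦ φ(G_f ∗ φ(w))`. -/
def conjOp (w : NCPoly) : ForestAlg →ₗ[ℚ] NCPoly :=
  phi.toLinearMap ∘ₗ evalOp (phi w)

theorem conjOp_apply (w : NCPoly) (f : ForestAlg) : conjOp w f = phi (forestOp f (phi w)) := rfl

theorem conjOp_mul_x_add_y (w : NCPoly) (f : ForestAlg) :
    conjOp (w * (x + y)) f = conjOp w f * (x + y) := by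
  have h : phi (x + y) = x := by rw [map_add, phi_x, phi_y]; abel
  rw [conjOp_apply, conjOp_apply, map_mul, h, forestOp_mul_x, map_mul, phi_x]

theorem conjOp_mul_x (w : NCPoly) (s : Multiset RootedTree) :
    conjOp (w * x) (forest s) =
      pair (conjOp w) (LinearMap.mulLeft ℚ x ∘ₗ conjOp 1) (coproduct (forest s)) := by
  have h : phi (x + y) = x := by rw [map_add, phi_x, phi_y]; abel
  have hD : ∀ D, phi (pair (evalOp (phi w)) (LinearMap.mulLeft ℚ (x + y) ∘ₗ evalOp 1) D) =
      pair (conjOp w) (LinearMap.mulLeft ℚ x ∘ₗ conjOp 1) D := by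
    intro D
    induction D using TensorProduct.induction_on with
    | zero => simp
    | add a b ha hb => simp only [map_add, ha, hb]
    | tmul a b =>
      simp only [pair_tmul, LinearMap.comp_apply, LinearMap.mulLeft_apply, evalOp_apply, map_mul,
        conjOp_apply, map_one, h]
  have h1 := forestOp_mul_add_mul s (phi w) 1
  rw [mul_one] at h1
  rw [conjOp_apply, map_mul, phi_x, h1, hD]

theorem conjOp_add (v w : NCPoly) : conjOp (v + w) = conjOp v + conjOp w := by
  ext f
  simp [conjOp_apply]

theorem conjOp_smul (c : ℚ) (w : NCPoly) : conjOp (c • w) = c • conjOp w := by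
  ext f
  simp [conjOp_apply]

theorem conjOp_sub (v w : NCPoly) : conjOp (v - w) = conjOp v - conjOp w := by
  ext f
  simp [conjOp_apply]

/-- Auxiliary to `rho`: the values of the rooted tree maps at a word. -/
def rhoWord : List Letter → (ForestAlg →ₗ[ℚ] NCPoly)
  | [] => counit.toLinearMap.smulRight 1
  | Letter.x :: w =>
      LinearMap.mulLeft ℚ x ∘ₗ conjOp (FreeMonoid.lift letter (FreeMonoid.ofList w))
  | Letter.y :: w => LinearMap.mulLeft ℚ (x + y) ∘ₗ rhoWord w
      - LinearMap.mulLeft ℚ x ∘ₗ conjOp (FreeMonoid.lift letter (FreeMonoid.ofList w))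

/-- The rooted tree maps, given by `f(1) = ε(f)`, `f(x w) = x φ(G_f ∗ φ(w))` and
`f((x + y) w) = (x + y) f(w)`. -/
def rho : ForestAlg →ₗ[ℚ] Module.End ℚ NCPoly :=
  ((FreeAlgebra.basisFreeMonoid ℚ Letter).constr ℚ
    fun w => rhoWord w.toList : NCPoly →ₗ[ℚ] ForestAlg →ₗ[ℚ] NCPoly).flip

theorem rho_lift (f : ForestAlg) (w : FreeMonoid Letter) :
    rho f (FreeMonoid.lift letter w) = rhoWord w.toList f := by
  rw [← basisFreeMonoid_apply, rho, LinearMap.flip_apply, Module.Basis.constr_basis]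

theorem rho_one (f : ForestAlg) : rho f 1 = counit f • 1 := by
  have := rho_lift f 1
  rw [map_one] at this
  rw [this]
  rfl

theorem rho_x_mul (f : ForestAlg) (w : NCPoly) : rho f (x * w) = x * conjOp w f := by
  induction w using lift_letter_induction with
  | add a b ha hb => rw [mul_add, map_add, ha, hb, conjOp_add, LinearMap.add_apply, mul_add]
  | smul c a ha =>
    rw [mul_smul_comm, map_smul, ha, conjOp_smul, LinearMap.smul_apply, mul_smul_comm]
  | word w =>
    have h : x * FreeMonoid.lift letter w = FreeMonoid.lift letter (FreeMonoid.of Letter.x * w) := by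
      rw [map_mul, FreeMonoid.lift_eval_of]; rfl
    rw [h, rho_lift]
    rfl

theorem rho_y_mul (f : ForestAlg) (w : NCPoly) :
    rho f (y * w) = (x + y) * rho f w - x * conjOp w f := by
  induction w using lift_letter_induction with
  | add a b ha hb =>
    rw [mul_add, map_add, ha, hb, conjOp_add, LinearMap.add_apply, map_add]
    noncomm_ring
  | smul c a ha =>
    rw [mul_smul_comm, map_smul, ha, conjOp_smul, LinearMap.smul_apply, map_smul, mul_smul_comm,
      mul_smul_comm, smul_sub]
  | word w =>
    have h : y * FreeMonoid.lift letter w = FreeMonoid.lift letter (FreeMonoid.of Letter.y * w) := by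
      rw [map_mul, FreeMonoid.lift_eval_of]; rfl
    rw [h, rho_lift, rho_lift]
    rfl

theorem rho_x (f : ForestAlg) : rho f x = x * conjOp 1 f := by
  simpa using rho_x_mul f 1

theorem rho_y (f : ForestAlg) : rho f y = counit f • (x + y) - x * conjOp 1 f := by
  simpa [rho_one] using rho_y_mul f 1

theorem rho_flip_x : rho.flip x = LinearMap.mulLeft ℚ x ∘ₗ conjOp 1 :=
  LinearMap.ext rho_x

theorem rho_flip_y : rho.flip y =
    counit.toLinearMap.smulRight (x + y) - LinearMap.mulLeft ℚ x ∘ₗ conjOp 1 :=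
  LinearMap.ext rho_y

theorem rho_flip_one : rho.flip 1 = counit.toLinearMap.smulRight 1 :=
  LinearMap.ext rho_one

theorem pair_sub_right (α β γ : ForestAlg →ₗ[ℚ] NCPoly) (D : ForestAlg ⊗[ℚ] ForestAlg) :
    pair α (β - γ) D = pair α β D - pair α γ D := by
  induction D using TensorProduct.induction_on with
  | zero => simp
  | add a b ha hb =>
    simp only [map_add, ha, hb]
    abel
  | tmul a b => simp [mul_sub]

theorem pair_sub_left (α β γ : ForestAlg →ₗ[ℚ] NCPoly) (D : ForestAlg ⊗[ℚ] ForestAlg) :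
    pair (α - β) γ D = pair α γ D - pair β γ D := by
  induction D using TensorProduct.induction_on with
  | zero => simp
  | add a b ha hb =>
    simp only [map_add, ha, hb]
    abel
  | tmul a b => simp [sub_mul]

theorem conjOp_mul_letter (w : NCPoly) (u : Letter) (s : Multiset RootedTree) :
    conjOp (w * letter u) (forest s) =
      pair (conjOp w) (rho.flip (letter u)) (coproduct (forest s)) := by
  cases u
  · change conjOp (w * x) (forest s) = pair _ (rho.flip x) _
    rw [rho_flip_x, conjOp_mul_x]
  · change conjOp (w * y) (forest s) = pair _ (rho.flip y) _
    have hy : w * y = w * (x + y) - w * x := by noncomm_ring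
    rw [rho_flip_y, hy, conjOp_sub, LinearMap.sub_apply, conjOp_mul_x_add_y, conjOp_mul_x,
      pair_sub_right, pair_counit_right]

theorem pair_mulLeft (c : NCPoly) (α β : ForestAlg →ₗ[ℚ] NCPoly)
    (D : ForestAlg ⊗[ℚ] ForestAlg) :
    pair (LinearMap.mulLeft ℚ c ∘ₗ α) β D = c * pair α β D := by
  induction D using TensorProduct.induction_on with
  | zero => simp
  | add a b ha hb => simp only [map_add, mul_add, ha, hb]
  | tmul a b => simp [mul_assoc]

theorem rho_mul_letter (s : Multiset RootedTree) (w : NCPoly) (u : Letter) :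
    rho (forest s) (w * letter u) =
      pair (rho.flip w) (rho.flip (letter u)) (coproduct (forest s)) := by
  induction w using induction_left with
  | one => rw [rho_flip_one, pair_counit_left, one_mul, one_mul, LinearMap.flip_apply]
  | x_mul w _ =>
    have h : rho.flip (x * w) = LinearMap.mulLeft ℚ x ∘ₗ conjOp w :=
      LinearMap.ext fun f => rho_x_mul f w
    rw [h, mul_assoc, rho_x_mul, conjOp_mul_letter, pair_mulLeft]
  | y_mul w ih =>
    have h : rho.flip (y * w) =
        LinearMap.mulLeft ℚ (x + y) ∘ₗ rho.flip w - LinearMap.mulLeft ℚ x ∘ₗ conjOp w :=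
      LinearMap.ext fun f => rho_y_mul f w
    rw [h, mul_assoc, rho_y_mul, ih, conjOp_mul_letter, pair_sub_left, pair_mulLeft, pair_mulLeft]
  | add a b ha hb =>
    rw [add_mul, map_add, ha, hb, map_add]
    simp [pair, TensorProduct.map_add_left]
  | smul c a ha =>
    rw [smul_mul_assoc, map_smul, ha, map_smul]
    simp [pair, TensorProduct.map_smul_left]

theorem forestOp_vertex_one : forestOp vertex 1 = -y := by
  rw [vertex, ← bPlus_forest, forestOp_bPlus_one, forest_zero, map_one forestOp, Module.End.one_apply,
    graftOp_one]

theorem rho_mul_one (f g : ForestAlg) : conjOp (conjOp 1 g) f = conjOp 1 (f * g) := by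
  rw [conjOp_apply, conjOp_apply, conjOp_apply, phi_phi, map_mul, Module.End.mul_apply]

/-- For `t = B₊(f)` the operation `Λ` turns into `v y ↦ v (x + 2 y) y`. -/
theorem exists_conjOp_one_eq {s : Multiset RootedTree} (hs : s ≠ 0) :
    ∃ v, conjOp 1 (forest s) = v * y ∧ conjOp 1 (tree (graft s)) = v * (x + 2 * y) * y := by
  obtain ⟨v, hv⟩ := mem_Hy.1 (forestOp_one_mem_Hy hs)
  refine ⟨-phi v, ?_, ?_⟩
  · rw [conjOp_apply, map_one, hv, map_mul, phi_y]
    noncomm_ring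
  · rw [conjOp_apply, map_one, ← bPlus_forest, forestOp_bPlus_one, hv, graftOp_mul_y, map_mul,
      map_mul, map_sub, phi_x, phi_y]
    noncomm_ring

theorem isRootedTreeMap_rho : IsRootedTreeMap rho where
  empty := by
    apply LinearMap.ext
    intro w
    rw [forest_zero, LinearMap.id_apply]
    induction w using induction_left with
    | one => rw [rho_one, map_one, one_smul]
    | x_mul w _ => rw [rho_x_mul, conjOp_apply, map_one, Module.End.one_apply, phi_phi]
    | y_mul w ih =>
      rw [rho_y_mul, ih, conjOp_apply, map_one, Module.End.one_apply, phi_phi]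
      noncomm_ring
    | add a b ha hb => rw [map_add, ha, hb]
    | smul c a ha => rw [map_smul, ha]
  mul_letter s _ w u := by rw [tensorAct_eq_pair, rho_mul_letter]
  vertex_x := by
    rw [rho_x, conjOp_apply, map_one, forestOp_vertex_one, map_neg, phi_y, neg_neg]
  vertex_y := by
    rw [rho_y, conjOp_apply, map_one, forestOp_vertex_one, map_neg, phi_y, neg_neg, vertex,
      counit_tree, zero_smul, zero_sub]
  tree_letter s hs u := by
    obtain ⟨v, h₁, h₂⟩ := exists_conjOp_one_eq hs
    cases u
    · refine ⟨x * v, ?_, ?_⟩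
      · change rho _ x = _
        rw [rho_x, h₁, mul_assoc]
      · change rho _ x = _
        rw [rho_x, h₂]
        noncomm_ring
    · refine ⟨-(x * v), ?_, ?_⟩
      · change rho _ y = _
        rw [rho_y, h₁, counit_forest hs, zero_smul]
        noncomm_ring
      · change rho _ y = _
        rw [rho_y, h₂, counit_tree, zero_smul]
        noncomm_ring
  product_letter s t hs ht u := by
    cases u
    · change rho _ x = rho _ (rho _ x)
      rw [rho_x, rho_x, rho_x_mul, rho_mul_one]
    · change rho _ y = rho _ (rho _ y)
      rw [rho_y, rho_y, map_mul, counit_forest hs, counit_forest ht, mul_zero, zero_smul, zero_sub,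
        zero_sub, map_neg, rho_x_mul, rho_mul_one]

/-! ### Uniqueness of the rooted tree maps -/

/-- The homogeneous part of degree `n` of `ℋ ⊗ ℋ`. -/
def tensorDeg (n : ℕ) : Submodule ℚ (ForestAlg ⊗[ℚ] ForestAlg) :=
  Submodule.span ℚ {D | ∃ a b, deg a + deg b = n ∧ D = forest a ⊗ₜ forest b}

/-- The part of `tensorDeg n` where the second factor has no constant term. -/
def tensorDegPos (n : ℕ) : Submodule ℚ (ForestAlg ⊗[ℚ] ForestAlg) :=
  Submodule.span ℚ {D | ∃ a b, deg a + deg b = n ∧ b ≠ 0 ∧ D = forest a ⊗ₜ forest b}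

theorem tensorDegPos_le (n : ℕ) : tensorDegPos n ≤ tensorDeg n :=
  Submodule.span_mono fun _ ⟨a, b, h, _, e⟩ => ⟨a, b, h, e⟩

theorem tmul_one_mem_tensorDeg (s : Multiset RootedTree) :
    forest s ⊗ₜ[ℚ] (1 : ForestAlg) ∈ tensorDeg (deg s) :=
  Submodule.subset_span ⟨s, 0, by simp, by simp⟩

theorem mul_mem_tensorDegPos {m n : ℕ} {D E : ForestAlg ⊗[ℚ] ForestAlg}
    (hD : D ∈ tensorDegPos m) (hE : E ∈ tensorDeg n) : D * E ∈ tensorDegPos (m + n) := by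
  induction hD using Submodule.span_induction with
  | zero => rw [zero_mul]; exact zero_mem _
  | add a b _ _ ha hb => rw [add_mul]; exact add_mem ha hb
  | smul c a _ ha => rw [smul_mul_assoc]; exact Submodule.smul_mem _ c ha
  | mem D hD =>
    induction hE using Submodule.span_induction with
    | zero => rw [mul_zero]; exact zero_mem _
    | add a b _ _ ha hb => rw [mul_add]; exact add_mem ha hb
    | smul c a _ ha => rw [mul_smul_comm]; exact Submodule.smul_mem _ c ha
    | mem E hE =>
      obtain ⟨a, b, h, hb, rfl⟩ := hD
      obtain ⟨a', b', h', rfl⟩ := hE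
      refine Submodule.subset_span ⟨a + a', b + b', ?_, ?_, ?_⟩
      · rw [deg_add, deg_add]; omega
      · simp [hb]
      · rw [Algebra.TensorProduct.tmul_mul_tmul, forest_add, forest_add]

/-- The coproduct is homogeneous, and the terms other than `f ⊗ 𝕀` have a first factor of lower
degree. -/
theorem coproduct_sub_mem (s : Multiset RootedTree) :
    coproduct (forest s) - forest s ⊗ₜ[ℚ] 1 ∈ tensorDegPos (deg s) := by
  induction s using forest_induction with
  | zero => simp [Algebra.TensorProduct.one_def]
  | graft s hs =>
    have h : coproduct (forest s) ∈ tensorDeg (deg s) := by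
      rw [← sub_add_cancel (coproduct (forest s)) (forest s ⊗ₜ[ℚ] 1)]
      exact add_mem (tensorDegPos_le _ hs) (tmul_one_mem_tensorDeg s)
    rw [forest_singleton, coproduct_tree_graft, add_sub_cancel_left, deg_singleton, treeDeg_graft]
    generalize coproduct (forest s) = D at h
    induction h using Submodule.span_induction with
    | zero => rw [map_zero]; exact zero_mem _
    | add a b _ _ ha hb => rw [map_add]; exact add_mem ha hb
    | smul c a _ ha => rw [map_smul]; exact Submodule.smul_mem _ c ha
    | mem D h =>
      obtain ⟨a, b, h, rfl⟩ := h
      refine Submodule.subset_span ⟨a, {graft b}, ?_, Multiset.singleton_ne_zero _, ?_⟩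
      · rw [deg_singleton, treeDeg_graft]; omega
      · rw [TensorProduct.map_tmul, bPlus_forest, forest_singleton, LinearMap.id_apply]
  | add s t _ _ hs ht =>
    have h : coproduct (forest t) ∈ tensorDeg (deg t) := by
      rw [← sub_add_cancel (coproduct (forest t)) (forest t ⊗ₜ[ℚ] 1)]
      exact add_mem (tensorDegPos_le _ ht) (tmul_one_mem_tensorDeg t)
    have e : coproduct (forest (s + t)) - forest (s + t) ⊗ₜ[ℚ] 1 =
        (coproduct (forest s) - forest s ⊗ₜ[ℚ] 1) * coproduct (forest t)
          + (coproduct (forest t) - forest t ⊗ₜ[ℚ] 1) * (forest s ⊗ₜ[ℚ] 1) := by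
      have e' : forest (s + t) ⊗ₜ[ℚ] (1 : ForestAlg) =
          (forest s ⊗ₜ[ℚ] (1 : ForestAlg)) * (forest t ⊗ₜ[ℚ] (1 : ForestAlg)) := by
        rw [Algebra.TensorProduct.tmul_mul_tmul, forest_add, one_mul]
      rw [e', forest_add, map_mul]
      ring
    rw [e, deg_add]
    refine add_mem (mul_mem_tensorDegPos hs h) ?_
    rw [add_comm]
    exact mul_mem_tensorDegPos ht (tmul_one_mem_tensorDeg s)

theorem coproduct_mem_tensorDeg (s : Multiset RootedTree) :
    coproduct (forest s) ∈ tensorDeg (deg s) := by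
  rw [← sub_add_cancel (coproduct (forest s)) (forest s ⊗ₜ[ℚ] 1)]
  exact add_mem (tensorDegPos_le _ (coproduct_sub_mem s)) (tmul_one_mem_tensorDeg s)

theorem mul_x_injective {v w : NCPoly} (h : v * x = w * x) : v = w := by
  rw [← lastCoeff_x_mul_x v, h, lastCoeff_x_mul_x]

theorem mul_y_injective {v w : NCPoly} (h : v * y = w * y) : v = w := by
  rw [← lastCoeff_y_mul_y v, h, lastCoeff_y_mul_y]

/-- The values at the letters are determined by the rooted tree maps of lower degree. -/
theorem IsRootedTreeMap.apply_letter_eq {ρ σ : ForestAlg →ₗ[ℚ] Module.End ℚ NCPoly}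
    (hρ : IsRootedTreeMap ρ) (hσ : IsRootedTreeMap σ) {s : Multiset RootedTree}
    (ih : ∀ r, deg r < deg s → ρ (forest r) = σ (forest r)) (u : Letter) :
    ρ (forest s) (letter u) = σ (forest s) (letter u) := by
  rcases forest_cases s with rfl | ⟨r, rfl⟩ | ⟨a, b, ha, hb, rfl⟩
  · rw [hρ.empty, hσ.empty]
  · rw [forest_singleton]
    rcases eq_or_ne r 0 with rfl | hr
    · cases u
      · exact hρ.vertex_x.trans hσ.vertex_x.symm
      · exact hρ.vertex_y.trans hσ.vertex_y.symm
    · obtain ⟨v, h₁, h₂⟩ := hρ.tree_letter r hr u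
      obtain ⟨v', h₁', h₂'⟩ := hσ.tree_letter r hr u
      rw [ih r (by rw [deg_singleton, treeDeg_graft]; omega), h₁'] at h₁
      rw [h₂, h₂', mul_y_injective h₁]
  · have := deg_pos ha
    have := deg_pos hb
    rw [forest_add, hρ.product_letter a b ha hb, hσ.product_letter a b ha hb,
      ih a (by rw [deg_add]; omega), ih b (by rw [deg_add]; omega)]

theorem pair_congr_tensorDeg {n : ℕ} {α β α' β' : ForestAlg →ₗ[ℚ] NCPoly}
    (hα : ∀ s, deg s ≤ n → α (forest s) = α' (forest s))
    (hβ : ∀ s, deg s ≤ n → β (forest s) = β' (forest s)) {D : ForestAlg ⊗[ℚ] ForestAlg}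
    (hD : D ∈ tensorDeg n) : pair α β D = pair α' β' D := by
  induction hD using Submodule.span_induction with
  | zero => rw [map_zero, map_zero]
  | add a b _ _ ha hb => rw [map_add, map_add, ha, hb]
  | smul c a _ ha => rw [map_smul, map_smul, ha]
  | mem D h =>
    obtain ⟨a, b, h, rfl⟩ := h
    rw [pair_tmul, pair_tmul, hα a (by omega), hβ b (by omega)]

theorem pair_congr_tensorDegPos {n : ℕ} {α β α' β' : ForestAlg →ₗ[ℚ] NCPoly}
    (hα : ∀ s, deg s < n → α (forest s) = α' (forest s))
    (hβ : ∀ s, deg s ≤ n → β (forest s) = β' (forest s)) {D : ForestAlg ⊗[ℚ] ForestAlg}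
    (hD : D ∈ tensorDegPos n) : pair α β D = pair α' β' D := by
  induction hD using Submodule.span_induction with
  | zero => rw [map_zero, map_zero]
  | add a b _ _ ha hb => rw [map_add, map_add, ha, hb]
  | smul c a _ ha => rw [map_smul, map_smul, ha]
  | mem D h =>
    obtain ⟨a, b, h, hb, rfl⟩ := h
    have := deg_pos hb
    rw [pair_tmul, pair_tmul, hα a (by omega), hβ b (by omega)]

/-- The recursion at the word `x` determines `f(1)`. -/
theorem IsRootedTreeMap.apply_one_eq {ρ σ : ForestAlg →ₗ[ℚ] Module.End ℚ NCPoly}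
    (hρ : IsRootedTreeMap ρ) (hσ : IsRootedTreeMap σ) {s : Multiset RootedTree}
    (ih : ∀ r, deg r < deg s → ρ (forest r) = σ (forest r))
    (hx : ∀ r, deg r ≤ deg s → ρ (forest r) x = σ (forest r) x) :
    ρ (forest s) 1 = σ (forest s) 1 := by
  rcases eq_or_ne s 0 with rfl | hs
  · rw [hρ.empty, hσ.empty]
  have key : ∀ {τ : ForestAlg →ₗ[ℚ] Module.End ℚ NCPoly}, IsRootedTreeMap τ →
      τ (forest s) 1 * x = τ (forest s) x -
        pair (τ.flip 1) (τ.flip x) (coproduct (forest s) - forest s ⊗ₜ[ℚ] 1) := by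
    intro τ hτ
    have h := hτ.mul_letter s hs 1 Letter.x
    rw [tensorAct_eq_pair, map_one, one_mul] at h
    change τ (forest s) x = pair _ (τ.flip x) _ at h
    have h1 : τ 1 = LinearMap.id := by rw [← forest_zero]; exact hτ.empty
    rw [map_sub, ← h, pair_tmul, LinearMap.flip_apply, LinearMap.flip_apply, h1, LinearMap.id_apply,
      sub_sub_cancel]
  apply mul_x_injective
  rw [key hρ, key hσ, hx s le_rfl]
  congr 1
  refine pair_congr_tensorDegPos (fun r hr => ?_) hx (coproduct_sub_mem s)
  rw [LinearMap.flip_apply, LinearMap.flip_apply, ih r hr]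

/-- In each degree the letters come first, then the word `1`, then the longer words. -/
theorem IsRootedTreeMap.unique {ρ σ : ForestAlg →ₗ[ℚ] Module.End ℚ NCPoly}
    (hρ : IsRootedTreeMap ρ) (hσ : IsRootedTreeMap σ) : ρ = σ := by
  have main : ∀ (n : ℕ) (s : Multiset RootedTree), deg s ≤ n → ρ (forest s) = σ (forest s) := by
    intro n
    induction n with
    | zero =>
      intro s hs
      have : s = 0 := by
        by_contra h
        have := deg_pos h
        omega
      rw [this, hρ.empty, hσ.empty]
    | succ n ih =>
      have hletter : ∀ s, deg s ≤ n + 1 → ∀ u, ρ (forest s) (letter u) = σ (forest s) (letter u) :=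
        fun s hs u => hρ.apply_letter_eq hσ (fun r hr => ih r (by omega)) u
      have hword : ∀ (w : List Letter) (s), deg s ≤ n + 1 →
          ρ (forest s) (FreeMonoid.lift letter (FreeMonoid.ofList w)) =
            σ (forest s) (FreeMonoid.lift letter (FreeMonoid.ofList w)) := by
        intro w
        induction w using List.reverseRecOn with
        | nil =>
          intro s hs
          change ρ (forest s) (FreeMonoid.lift letter 1) = σ (forest s) (FreeMonoid.lift letter 1)
          rw [map_one]
          exact hρ.apply_one_eq hσ (fun r hr => ih r (by omega))
            fun r hr => hletter r (by omega) Letter.x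
        | append_singleton w u ihw =>
          intro s hs
          rcases eq_or_ne s 0 with rfl | hs0
          · rw [hρ.empty, hσ.empty]
          have hwu : FreeMonoid.lift letter (FreeMonoid.ofList (w ++ [u])) =
              FreeMonoid.lift letter (FreeMonoid.ofList w) * letter u := by
            change FreeMonoid.lift letter (FreeMonoid.ofList w * FreeMonoid.of u) = _
            rw [map_mul, FreeMonoid.lift_eval_of]
          rw [hwu, hρ.mul_letter s hs0, hσ.mul_letter s hs0, tensorAct_eq_pair, tensorAct_eq_pair]
          exact pair_congr_tensorDeg (fun r hr => ihw r (hr.trans hs))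
            (fun r hr => hletter r (hr.trans hs) u) (coproduct_mem_tensorDeg s)
      intro s hs
      apply LinearMap.ext
      intro w
      induction w using lift_letter_induction with
      | word w => exact hword w s hs
      | add a b ha hb => rw [map_add, map_add, ha, hb]
      | smul c a ha => rw [map_smul, map_smul, ha]
  apply LinearMap.ext
  intro f
  induction f using forestAlg_induction with
  | forest s => exact main _ s le_rfl
  | add a b ha hb => rw [map_add, map_add, ha, hb]
  | smul c a ha => rw [map_smul, map_smul, ha]

/-! ### The elements `G_f` for `f ∈ ℱ` fill `𝔥 y` -/

/-- The homogeneous part of degree `n` of `𝔥`. -/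
def polyDeg : ℕ → Submodule ℚ NCPoly
  | 0 => Submodule.span ℚ {1}
  | n + 1 => (polyDeg n).map (LinearMap.mulRight ℚ x) ⊔ (polyDeg n).map (LinearMap.mulRight ℚ y)

theorem mem_polyDeg_succ {n : ℕ} {u : NCPoly} :
    u ∈ polyDeg (n + 1) ↔ ∃ v ∈ polyDeg n, ∃ w ∈ polyDeg n, v * x + w * y = u := by
  simp [polyDeg, Submodule.mem_sup]

theorem mul_x_mem_polyDeg {n : ℕ} {u : NCPoly} (h : u ∈ polyDeg n) : u * x ∈ polyDeg (n + 1) :=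
  mem_polyDeg_succ.2 ⟨u, h, 0, zero_mem _, by simp⟩

theorem mul_y_mem_polyDeg {n : ℕ} {u : NCPoly} (h : u ∈ polyDeg n) : u * y ∈ polyDeg (n + 1) :=
  mem_polyDeg_succ.2 ⟨0, zero_mem _, u, h, by simp⟩

theorem act_y_one : act y 1 = y := by
  refine act_apply_one ?_
  simpa using mul_y_mem_H1 1

theorem act_y_mul_y (w : NCPoly) : act y (w * y) = act y w * y + w * x * y + w * y * y := by
  have h := act_graftOp_mul_y (zWord_mem_H1 []) w
  rw [zWord_nil, graftOp_one, act_one, Module.End.one_apply, Module.End.one_apply, graftOp_mul_y,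
    map_neg, LinearMap.neg_apply, LinearMap.neg_apply] at h
  rw [← neg_inj, h]
  noncomm_ring

theorem act_y_mem_polyDeg {n : ℕ} {u : NCPoly} (h : u ∈ polyDeg n) :
    act y u ∈ polyDeg (n + 1) := by
  induction n generalizing u with
  | zero =>
    obtain ⟨r, rfl⟩ := Submodule.mem_span_singleton.1 h
    rw [map_smul, act_y_one, ← one_mul y]
    exact Submodule.smul_mem _ _ (mul_y_mem_polyDeg (Submodule.mem_span_singleton_self _))
  | succ n ih =>
    obtain ⟨v, hv, w, hw, rfl⟩ := mem_polyDeg_succ.1 h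
    rw [map_add, act_mul_x, act_y_mul_y]
    exact add_mem (mul_x_mem_polyDeg (ih hv)) (add_mem (add_mem (mul_y_mem_polyDeg (ih hw))
      (mul_y_mem_polyDeg (mul_x_mem_polyDeg hw))) (mul_y_mem_polyDeg (mul_y_mem_polyDeg hw)))

/-- The linear map with `w x ↦ a w`, `w y ↦ b w` and `1 ↦ 0`. -/
def dropLast (a b : ℚ) : NCPoly →ₗ[ℚ] NCPoly := a • lastCoeff Letter.x + b • lastCoeff Letter.y

@[simp] theorem dropLast_mul_x (a b : ℚ) (w : NCPoly) : dropLast a b (w * x) = a • w := by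
  simp [dropLast]

@[simp] theorem dropLast_mul_y (a b : ℚ) (w : NCPoly) : dropLast a b (w * y) = b • w := by
  simp [dropLast]

/-- For `0 < a < c` and `0 < b` the operator `T : v ↦ P(y ∗ v) + c v` with `P = dropLast a b` is
onto in each degree. The elements `T(b v x - a v y) = b (c - a) v x - a (b + c) v y` span the kernel
of `P' = dropLast (a (b + c)) (b (c - a))`, and `P'(T(v x))` is `a` times the value at `v` of the
operator with parameters `a (b + c)`, `b (c - a)`, `c (b + c)`, which again satisfy the
inequalities. -/
theorem exists_dropLast_act_y_add (n : ℕ) {a b c : ℚ} (ha : 0 < a) (hac : a < c) (hb : 0 < b)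
    {u : NCPoly} (hu : u ∈ polyDeg n) :
    ∃ v ∈ polyDeg n, dropLast a b (act y v) + c • v = u := by
  induction n generalizing a b c u with
  | zero =>
    obtain ⟨r, rfl⟩ := Submodule.mem_span_singleton.1 hu
    refine ⟨(r / (b + c)) • 1, Submodule.smul_mem _ _ (Submodule.mem_span_singleton_self _), ?_⟩
    have hy : dropLast a b y = b • 1 := by simpa using dropLast_mul_y a b 1
    have : b + c ≠ 0 := by linarith
    rw [map_smul, act_y_one, map_smul, hy, smul_smul, smul_smul, ← add_smul]
    congr 1
    field_simp
  | succ n ih =>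
    obtain ⟨s, hs, r, hr, rfl⟩ := mem_polyDeg_succ.1 hu
    have hc : 0 < c := ha.trans hac
    have hbc : 0 < b + c := by linarith
    have hca : 0 < c - a := sub_pos.2 hac
    obtain ⟨v, hv, hveq⟩ := ih (a := a * (b + c)) (b := b * (c - a)) (c := c * (b + c))
      (u := a⁻¹ • ((a * (b + c)) • s + (b * (c - a)) • r)) (by positivity)
      (mul_lt_mul_of_pos_right hac hbc) (by positivity)
      (Submodule.smul_mem _ _ (add_mem (Submodule.smul_mem _ _ hs) (Submodule.smul_mem _ _ hr)))
    obtain ⟨e, he, f, hf, hef⟩ := mem_polyDeg_succ.1 (act_y_mem_polyDeg hv)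
    rw [← hef, map_add, dropLast_mul_x, dropLast_mul_y] at hveq
    have hr' : r = (b * (c - a))⁻¹ • (a • ((a * (b + c)) • e + (b * (c - a)) • f
        + (c * (b + c)) • v) - (a * (b + c)) • s) := by
      rw [hveq]
      match_scalars
      · field_simp
      · field_simp
        ring
    -- With this `q`, the difference of `s x + r y` and `T(v x)` is `T(b q x - a q y)`.
    obtain ⟨q, hq⟩ : ∃ q, q = (b * (c - a))⁻¹ • (s - a • e - c • v) := ⟨_, rfl⟩
    have hqmem : q ∈ polyDeg n := by
      rw [hq]
      exact Submodule.smul_mem _ _ (sub_mem (sub_mem hs (Submodule.smul_mem _ _ he))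
        (Submodule.smul_mem _ _ hv))
    refine ⟨v * x + b • (q * x) - a • (q * y), sub_mem (add_mem (mul_x_mem_polyDeg hv)
      (Submodule.smul_mem _ _ (mul_x_mem_polyDeg hqmem)))
      (Submodule.smul_mem _ _ (mul_y_mem_polyDeg hqmem)), ?_⟩
    have h₁ : dropLast a b (act y (v * x + b • (q * x) - a • (q * y))) =
        a • (e * x + f * y) - (a * b) • (q * x + q * y) := by
      simp only [map_add, map_sub, map_smul, act_mul_x, act_y_mul_y, dropLast_mul_x, dropLast_mul_y,
        ← hef]
      module
    rw [h₁, hq, hr']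
    simp only [add_mul, sub_mul, smul_mul_assoc]
    match_scalars <;> field_simp <;> ring

theorem forestOp_vertex (w : NCPoly) : forestOp vertex w = -act y w := by
  rw [forestOp_eq_act, forestOp_vertex_one, map_neg, LinearMap.neg_apply]

/-- Modulo the elements `v (x - y) y`, which come from `B₊`, the products with `•` exhaust the
degree `n + 2` part of `𝔥 y`. -/
theorem exists_calF_forestOp_eq (n : ℕ) {u : NCPoly} (hu : u ∈ polyDeg n) :
    ∃ f ∈ calF (n + 1), forestOp f 1 = u * y := by
  induction n generalizing u with
  | zero =>
    obtain ⟨r, rfl⟩ := Submodule.mem_span_singleton.1 hu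
    refine ⟨(-r) • vertex, Submodule.smul_mem _ _ (Submodule.mem_span_singleton_self _), ?_⟩
    rw [map_smul, LinearMap.smul_apply, forestOp_vertex_one]
    simp
  | succ n ih =>
    obtain ⟨s, hs, r, hr, hsr⟩ := mem_polyDeg_succ.1 hu
    obtain ⟨v, hv, hveq⟩ := exists_dropLast_act_y_add n (a := 1) (b := 1) (c := 2) one_pos
      (by norm_num) one_pos (u := -(s + r)) (neg_mem (add_mem hs hr))
    obtain ⟨e, he, f, hf, hef⟩ := mem_polyDeg_succ.1 (act_y_mem_polyDeg hv)
    rw [← hef, map_add, dropLast_mul_x, dropLast_mul_y, one_smul, one_smul] at hveq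
    obtain ⟨g, hg, hg'⟩ := ih (add_mem (add_mem hs he) hv)
    obtain ⟨h, hh, hh'⟩ := ih hv
    refine ⟨bPlus g + vertex * h, Submodule.add_mem_sup (Submodule.mem_map_of_mem hg)
      (Submodule.mem_map_of_mem hh), ?_⟩
    have hr' : r = -(e + f + (2 : ℚ) • v) - s := by
      rw [hveq]
      abel
    rw [map_add, LinearMap.add_apply, forestOp_bPlus_one, hg', graftOp_mul_y, map_mul,
      Module.End.mul_apply, hh', forestOp_vertex, act_y_mul_y, ← hef, ← hsr, hr']
    simp only [add_mul, sub_mul, mul_sub, neg_mul, smul_mul_assoc]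
    module

theorem lift_letter_mem_polyDeg (w : List Letter) :
    FreeMonoid.lift letter (FreeMonoid.ofList w) ∈ polyDeg w.length := by
  induction w using List.reverseRecOn with
  | nil => exact Submodule.mem_span_singleton_self _
  | append_singleton w u ih =>
    have hwu : FreeMonoid.lift letter (FreeMonoid.ofList (w ++ [u])) =
        FreeMonoid.lift letter (FreeMonoid.ofList w) * letter u := by
      change FreeMonoid.lift letter (FreeMonoid.ofList w * FreeMonoid.of u) = _
      rw [map_mul, FreeMonoid.lift_eval_of]
    rw [hwu, List.length_append]
    cases u
    · exact mul_x_mem_polyDeg ih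
    · exact mul_y_mem_polyDeg ih

/-- The space `ℱ = ∑ ℱ_d`. -/
def calFSum : Submodule ℚ ForestAlg := ⨆ d : ℕ, ⨆ _ : 1 ≤ d, calF d

theorem calF_le_calFSum (n : ℕ) : calF (n + 1) ≤ calFSum :=
  le_iSup₂_of_le (n + 1) (Nat.succ_pos n) le_rfl

theorem exists_calFSum_forestOp_eq {v : NCPoly} (hv : v ∈ Hy) :
    ∃ f ∈ calFSum, forestOp f 1 = v := by
  obtain ⟨w, rfl⟩ := mem_Hy.1 hv
  clear hv
  induction w using lift_letter_induction with
  | word w =>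
    obtain ⟨f, hf, h⟩ := exists_calF_forestOp_eq _ (lift_letter_mem_polyDeg w.toList)
    exact ⟨f, calF_le_calFSum _ hf, h⟩
  | add a b ha hb =>
    obtain ⟨f, hf, h⟩ := ha
    obtain ⟨f', hf', h'⟩ := hb
    exact ⟨f + f', add_mem hf hf', by rw [map_add, LinearMap.add_apply, h, h', add_mul]⟩
  | smul c a ha =>
    obtain ⟨f, hf, h⟩ := ha
    exact ⟨c • f, Submodule.smul_mem _ c hf, by
      rw [map_smul, LinearMap.smul_apply, h, smul_mul_assoc]⟩

/-! ### Comparison with the Kawashima relations -/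

/-- The span of the non-empty forests. -/
def forestPos : Submodule ℚ ForestAlg :=
  Submodule.span ℚ {f | ∃ s : Multiset RootedTree, s ≠ 0 ∧ f = forest s}

theorem tree_mem_forestPos (t : RootedTree) : tree t ∈ forestPos :=
  Submodule.subset_span ⟨{t}, Multiset.singleton_ne_zero t, (forest_singleton t).symm⟩

theorem bPlus_mem_forestPos (f : ForestAlg) : bPlus f ∈ forestPos := by
  induction f using forestAlg_induction with
  | forest s => rw [bPlus_forest]; exact tree_mem_forestPos _
  | add a b ha hb => rw [map_add]; exact add_mem ha hb
  | smul c a ha => rw [map_smul]; exact Submodule.smul_mem _ c ha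

theorem tree_mul_mem_forestPos (t : RootedTree) (f : ForestAlg) : tree t * f ∈ forestPos := by
  induction f using forestAlg_induction with
  | forest s =>
    refine Submodule.subset_span ⟨{t} + s, ?_, ?_⟩
    · simp
    · rw [forest_add, forest_singleton]
  | add a b ha hb => rw [mul_add]; exact add_mem ha hb
  | smul c a ha => rw [mul_smul_comm]; exact Submodule.smul_mem _ c ha

theorem calF_le_forestPos (d : ℕ) : calF d ≤ forestPos := by
  match d with
  | 0 => exact bot_le
  | 1 =>
    rw [calF, Submodule.span_singleton_le_iff_mem]
    exact tree_mem_forestPos _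
  | d + 2 =>
    rw [calF, sup_le_iff, Submodule.map_le_iff_le_comap, Submodule.map_le_iff_le_comap]
    exact ⟨fun f _ => bPlus_mem_forestPos f, fun f _ => tree_mul_mem_forestPos _ f⟩

theorem tildeHPos_eq (ρ : ForestAlg →ₗ[ℚ] Module.End ℚ NCPoly) :
    tildeHPos ρ = forestPos.map ρ := by
  rw [tildeHPos, forestPos, Submodule.map_span]
  congr 1
  ext f
  constructor
  · rintro ⟨s, hs, rfl⟩
    exact ⟨_, ⟨s, hs, rfl⟩, rfl⟩
  · rintro ⟨_, ⟨s, hs, rfl⟩, rfl⟩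
    exact ⟨s, hs, rfl⟩

theorem tildeF_eq (ρ : ForestAlg →ₗ[ℚ] Module.End ℚ NCPoly) : tildeF ρ = calFSum.map ρ := by
  simp only [tildeF, calFSum, Submodule.map_iSup]

theorem tildeF_le_tildeHPos (ρ : ForestAlg →ₗ[ℚ] Module.End ℚ NCPoly) :
    tildeF ρ ≤ tildeHPos ρ := by
  rw [tildeF_eq, tildeHPos_eq]
  exact Submodule.map_mono (iSup₂_le fun d _ => calF_le_forestPos d)

theorem forestOp_one_mem_Hy_of_mem {f : ForestAlg} (hf : f ∈ forestPos) : forestOp f 1 ∈ Hy := by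
  induction hf using Submodule.span_induction with
  | mem _ h =>
    obtain ⟨s, hs, rfl⟩ := h
    exact forestOp_one_mem_Hy hs
  | zero => rw [map_zero]; exact zero_mem _
  | add a b _ _ ha hb => rw [map_add]; exact add_mem ha hb
  | smul c a _ ha => rw [map_smul]; exact Hy.smul_mem c ha

theorem counit_of_mem {f : ForestAlg} (hf : f ∈ forestPos) : counit f = 0 := by
  induction hf using Submodule.span_induction with
  | mem _ h =>
    obtain ⟨s, hs, rfl⟩ := h
    exact counit_forest hs
  | zero => exact map_zero _
  | add a b _ _ ha hb => rw [map_add, ha, hb, add_zero]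
  | smul c a _ ha => rw [map_smul, ha, smul_zero]

theorem mem_H0 {w : NCPoly} : w ∈ H0 ↔ ∃ (c : ℚ), ∃ v ∈ Hy, c • 1 + x * v = w := by
  simp [H0, xHy, Submodule.mem_sup, Submodule.mem_span_singleton]

theorem rho_x_mul_eq (f : ForestAlg) {v : NCPoly} (hv : v ∈ Hy) :
    rho f (x * v) = x * phi (harmonicProd (forestOp f 1) (phi v)) := by
  rw [rho_x_mul, conjOp_apply, ← act_of_mem_H1 _ (Hy_le_H1 (phi_mem_Hy hv)), ← forestOp_eq_act]

theorem values_tildeHPos_subset : values (tildeHPos rho) ⊆ kawashimaSet := by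
  rintro _ ⟨_, hf, w, hw, rfl⟩
  rw [tildeHPos_eq] at hf
  obtain ⟨f, hf, rfl⟩ := hf
  obtain ⟨c, v, hv, rfl⟩ := mem_H0.1 hw
  refine ⟨_, forestOp_one_mem_Hy_of_mem hf, _, phi_mem_Hy hv, ?_⟩
  rw [map_add, map_smul, rho_one, counit_of_mem hf, zero_smul, smul_zero, zero_add,
    rho_x_mul_eq f hv]

theorem kawashimaSet_subset : kawashimaSet ⊆ values (tildeF rho) := by
  rintro _ ⟨v, hv, w, hw, rfl⟩
  obtain ⟨f, hf, rfl⟩ := exists_calFSum_forestOp_eq hv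
  refine ⟨rho f, ?_, x * phi w, mem_H0.2 ⟨0, _, phi_mem_Hy hw, by rw [zero_smul, zero_add]⟩, ?_⟩
  · rw [tildeF_eq]
    exact Submodule.mem_map_of_mem hf
  · rw [rho_x_mul_eq f (phi_mem_Hy hw), phi_phi]

theorem values_mono {V W : Submodule ℚ (Module.End ℚ NCPoly)} (h : V ≤ W) :
    values V ⊆ values W := by
  rintro _ ⟨f, hf, w, hw, rfl⟩
  exact ⟨f, h hf, w, hw, rfl⟩

/-- Both families of relations state that `Z` vanishes on the same set, since `x a = a ⊛ y` for
`a ∈ 𝔥 y`. -/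
theorem rootedTreeMap_relations_iff {M : Type*} [AddCommGroup M] [Module ℚ M] (Z : H0 →ₗ[ℚ] M) :
    (∀ f ∈ tildeHPos rho, H0.map f ≤ kerZ Z) ↔
      ∀ v ∈ Hy, ∀ w ∈ Hy, circledast (phi (harmonicProd v w)) y ∈ kerZ Z := by
  have hc : ∀ v ∈ Hy, ∀ w ∈ Hy,
      circledast (phi (harmonicProd v w)) y = x * phi (harmonicProd v w) := fun v hv w hw =>
    circledast_y (phi_mem_Hy (harmonicProd_mem_Hy hv (Hy_le_H1 hw)))
  constructor
  · intro h v hv w hw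
    obtain ⟨f, hf, u, hu, e⟩ :=
      values_mono (tildeF_le_tildeHPos rho) (kawashimaSet_subset ⟨v, hv, w, hw, rfl⟩)
    rw [hc v hv w hw, e]
    exact h f hf (Submodule.mem_map_of_mem hu)
  · rintro h f hf _ ⟨u, hu, rfl⟩
    obtain ⟨v, hv, w, hw, e⟩ := values_tildeHPos_subset ⟨f, hf, u, hu, rfl⟩
    rw [e, ← hc v hv w hw]
    exact h v hv w hw

end

end RootedTreeMaps

theorem theorem4p1 :
    ∃ ρ : ForestAlg →ₗ[ℚ] Module.End ℚ NCPoly,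
      -- `ρ` is the assignment of rooted tree maps, well defined by its recursive definition
      IsRootedTreeMap ρ ∧
      (∀ ρ' : ForestAlg →ₗ[ℚ] Module.End ℚ NCPoly, IsRootedTreeMap ρ' → ρ' = ρ) ∧
      -- the inclusion `L_x φ(𝔥y ∗ 𝔥y) ⊆ {f(w) | f ∈ ℱ̃, w ∈ 𝔥⁰}`
      kawashimaSet ⊆ values (tildeF ρ) ∧
      -- the reverse inclusion, also for all rooted tree maps of non-zero degree
      values (tildeF ρ) ⊆ kawashimaSet ∧
      values (tildeHPos ρ) ⊆ kawashimaSet ∧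
      -- `ℱ̃` consists of rooted tree maps of non-zero degree
      tildeF ρ ≤ tildeHPos ρ ∧
      -- a linear map on `𝔥⁰` satisfies the rooted tree map relations if and only if it satisfies
      -- the linear part of the Kawashima relations
      (∀ (M : Type*) [AddCommGroup M] [Module ℚ M] (Z : H0 →ₗ[ℚ] M),
        (∀ f ∈ tildeHPos ρ, H0.map f ≤ kerZ Z) ↔
          ∀ v ∈ Hy, ∀ w ∈ Hy, circledast (phi (harmonicProd v w)) y ∈ kerZ Z) ∧
      -- in particular for the multiple zeta values
      ((∀ f ∈ tildeHPos ρ, H0.map f ≤ kerZ zetaMap) ↔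
        ∀ v ∈ Hy, ∀ w ∈ Hy, circledast (phi (harmonicProd v w)) y ∈ kerZ zetaMap) := by
  exact ⟨rho, isRootedTreeMap_rho, fun _ h => h.unique isRootedTreeMap_rho, kawashimaSet_subset,
    (values_mono (tildeF_le_tildeHPos rho)).trans values_tildeHPos_subset,
    values_tildeHPos_subset, tildeF_le_tildeHPos rho,
    fun _ _ _ Z => rootedTreeMap_relations_iff Z, rootedTreeMap_relations_iff zetaMap⟩
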